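/- **Setting.** Let $B$ be a stationary, properly ordered Bratteli diagram: $V_0=\{v_0\}$, $V_n=\{1,\dots,m\}$ for $n\ge 1$, finite edge sets $E_n$ from $V_{n-1}$ to $V_n$ with source and terminal maps $\mathbf s,\mathbf t$, a linear order on each set of edges with a common terminal vertex, and all the ordered edge sets $E_n$, $n\ge 2$, identified with one another; properly ordered means that there are exactly one infinite path of maximal edges and exactly one infinite path of minimal edges. Let $X_B$ be the space of infinite paths $x=(x_1,x_2,\dots)$ from $v_0$, assumed infinite (so that it is a Cantor set). The Vershik map $V_B:X_B\to X_B$ replaces the first non-maximal edge of $x$ by its successor and the edges before it by minimal edges, and sends the maximal path to the minimal one. Let $M_{i,j}$ be the number of edges from $i$ to $j$ in $E_n$ $(n\ge2)$, and assume: (H1) $M_{i,j}>0$ for all $i,j$; (H2) each $i\in V_1$ receives exactly one edge from $v_0$; (H3) each minimal edge of $E_n$, $n\ge 2$, starts at the vertex $1$. Let $\lambda$ be the Perron eigenvalue of $M$ and $r,l$ strictly positive right and left eigenvectors for $\lambda$, with $\sum_i r(i)=1$ and $\sum_i l(i)r(i)=1$. Let $\mu$ be the $V_B$-invariant Borel probability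 measure on $X_B$. For $I\subseteq X_B$ put $N_I^{(0)}=0$, $N^{(k)}_I(x)=\inf\{n>N^{(k-1)}_I(x):V_B^n x\in I\}$, and $$F_I^{(k)}(t)=\mu\{x:\mu(I)\,(N_I^{(k)}(x)-N_I^{(k-1)}(x))\le t\}\qquad(k\ge1).$$ Fix $x^*\in X_B$, let $I_n=[x_1^*,\dots,x_n^*]$ be the cylinder of the paths that begin with $x^*_1\dots x^*_n$, write $F_n^{(k)}=F_{I_n}^{(k)}$, and let $\mathcal N\subseteq\{1,2,\dots\}$ be an infinite set such that $\mathbf t(x_n^*)=i^*$ for all $n\in\mathcal N$, for a fixed vertex $i^*$. Let $E(a,b)$ be the set of paths $e_a\dots e_b$ with $e_q\in E_q$; by stationarity $E(n+1,n+q)$ is identified with $E(2,q+1)$ for $n\ge1$. **Theorem 2.4.** (a) For every path $ef\in E(2,3)$ with $\mathbf s(e)=i^*$ there is a vector $c(ef)\in\mathbb N^m$ such that, for every $n\ge 1$, every cylinder $I=[x_1,\dots,x_n]$ with $\mathbf t(x_n)=i^*$ and every $z\in[Ief]$, $c(ef)(i)$ is the number of times $0\le q<N_I^{(1)}(z)$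 at which $V_B^q z$ lies in the cylinder of the minimal path from $v_0$ to $i\in V_n$. For every $k\ge1$ and every $e_1\dots e_{k+1}\in E(2,k+2)$ with $\mathbf s(e_1)=i^*$ there is a path $e_1^{(k)}e_2^{(k)}\in E(2,3)$ with $\mathbf s(e_1^{(k)})=i^*$ such that $V_B^{N_I^{(k-1)}(z)}(z)\in[Ie_1^{(k)}e_2^{(k)}]$ for all such $n$, $I$ and all $z\in[Ie_1\dots e_{k+1}]$. Put $\bar c(ef)=\sum_i c(ef)(i)\,l(i)$, let $c_1<\dots<c_L$ be the distinct values of $\bar c(ef)$ over the paths $ef\in E(2,3)$ with $\mathbf s(e)=i^*$, let $S(j)$ be the set of those paths with $\bar c(ef)=c_j$, and put $d_0=0$, $d_j=c_j\,r(i^*)$ for $1\le j\le L$, $d_{L+1}=\infty$. (b) For $0\le j\le L$ and $d_j\le t<d_{j+1}$, $$\lim_{n\to\infty,\,n\in\mathcal N}F_n^{(1)}(t)=\sum_{ef\in\bigcup_{i=1}^jS(i)}\bar c(ef)\frac{r(\mathbf t(f))}{\lambda^2}+\frac{t}{r(i^*)}\sum_{ef\in\bigcup_{i=j+1}^LS(i)}\frac{r(\mathbf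 t(f))}{\lambda^2}.$$ (c) For $k\ge2$, $0\le j\le L$ and $d_j\le t<d_{j+1}$, with $t\ne d_j$ if $j\ge1$, $$\lim_{n\to\infty,\,n\in\mathcal N}F_n^{(k)}(t)=\sum_{\substack{e_1\dots e_{k+1}\in E(2,k+2):\ \mathbf s(e_1)=i^*,\\ e_1^{(k)}e_2^{(k)}\in\bigcup_{i=1}^jS(i)}}\bar c(e_1e_2)\frac{r(\mathbf t(e_{k+1}))}{\lambda^{k+1}}.$$ (d) For each $k\ge1$ and $0\le j\le L$, the convergence of $F_n^{(k)}$ along $\mathcal N$ is uniform on every closed set $K\subseteq\,]d_j,d_{j+1}[$ (closed in $\mathbb R$), in particular on every closed interval contained in $]d_j,d_{j+1}[$. -/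

import Mathlib

open MeasureTheory

/-- An ordered Bratteli diagram. `V n` is the finite set of vertices of level `n`, and `E n` is the
finite set of edges from `V n` to `V (n + 1)`, usually written `E_{n+1}`. Two edges are comparable
iff they have the same terminal vertex. -/
structure OrderedBratteliDiagram where
  V : ℕ → Type
  E : ℕ → Type
  s : ∀ n, E n → V n
  t : ∀ n, E n → V (n + 1)
  finV : ∀ n, Finite (V n)
  finE : ∀ n, Finite (E n)
  root : Nonempty (Unique (V 0))
  s_surj : ∀ n, Function.Surjective (s n)
  t_surj : ∀ n, Function.Surjective (t n)
  ord : ∀ n, PartialOrder (E n)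
  comparable_iff : ∀ n (e f : E n), (e ≤ f ∨ f ≤ e) ↔ t n e = t n f

namespace OrderedBratteliDiagram

attribute [instance] ord finV finE

variable (B : OrderedBratteliDiagram)

/-- The space `X_B` of infinite paths starting at the root; the `n`-th edge is `x.1 (n - 1)`. -/
def Path : Type := {x : ∀ n, B.E n // ∀ n, B.t n (x n) = B.s (n + 1) (x (n + 1))}

variable {B}

/-- The cylinder `[x₁, …, xₙ]`. -/
def cyl (x : B.Path) (n : ℕ) : Set B.Path := {y | ∀ i < n, y.1 i = x.1 i}

/-- The σ-algebra generated by the cylinders. The cylinders are a countable base of the topology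
of `X_B`, so this is the Borel σ-algebra. -/
instance : MeasurableSpace B.Path :=
  MeasurableSpace.generateFrom {A | ∃ (x : B.Path) (n : ℕ), A = cyl x n}

/-- All edges of the path are maximal. -/
def AllMax (x : B.Path) : Prop := ∀ n, IsMax (x.1 n)

/-- All edges of the path are minimal. -/
def AllMin (x : B.Path) : Prop := ∀ n, IsMin (x.1 n)

variable (B) in
/-- There is exactly one path of maximal edges and exactly one path of minimal edges. -/
def ProperlyOrdered : Prop := (∃! x : B.Path, AllMax x) ∧ (∃! x : B.Path, AllMin x)

/-- `y` arises from `x` by replacing the first non-maximal edge `x_k` by its successor, and all the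
edges before it by minimal edges. -/
def IsSucc (x y : B.Path) : Prop :=
  ∃ k, (∀ i < k, IsMax (x.1 i)) ∧ x.1 k ⋖ y.1 k ∧ (∀ i < k, IsMin (y.1 i)) ∧
    ∀ i, k < i → y.1 i = x.1 i

theorem exists_min_edge (n : ℕ) (v : B.V (n + 1)) : ∃ e : B.E n, IsMin e ∧ B.t n e = v := by
  obtain ⟨e, he⟩ := B.t_surj n v
  obtain ⟨f, hf, hm⟩ := (Set.toFinite {g : B.E n | g ≤ e}).exists_minimal ⟨e, le_refl e⟩
  refine ⟨f, fun g hg => hm (le_trans hg hf) hg, ?_⟩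
  rw [← he]
  exact (B.comparable_iff n f e).1 (Or.inl hf)

theorem exists_min_prefix (x : B.Path) (k : ℕ) (f : B.E k) :
    ∃ p : ∀ n, B.E n, p k = f ∧
      ∀ n < k, IsMin (p n) ∧ B.t n (p n) = B.s (n + 1) (p (n + 1)) := by
  induction k with
  | zero => exact ⟨Function.update x.1 0 f, by simp, by simp⟩
  | succ k ih =>
    obtain ⟨g, hg, hgt⟩ := exists_min_edge k (B.s (k + 1) f)
    obtain ⟨p, hp, hq⟩ := ih g
    refine ⟨Function.update p (k + 1) f, by simp, fun n hn => ?_⟩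
    rcases Nat.lt_succ_iff_lt_or_eq.1 hn with h | h
    · have h1 : n ≠ k + 1 := by omega
      have h2 : n + 1 ≠ k + 1 := by omega
      simpa [Function.update_of_ne h1, Function.update_of_ne h2] using hq n h
    · subst h
      have h1 : n ≠ n + 1 := by omega
      simp [hp, hg, hgt]

theorem exists_succ (x : B.Path) (hx : ¬ AllMax x) : ∃ y, IsSucc x y := by
  classical
  have hx' : ∃ n, ¬ IsMax (x.1 n) := by simpa [AllMax] using hx
  have hk := Nat.find_spec hx'
  have hlt : ∀ i < Nat.find hx', IsMax (x.1 i) := fun i hi => not_not.1 (Nat.find_min hx' hi)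
  generalize Nat.find hx' = k at hk hlt
  obtain ⟨g, hg⟩ := not_isMax_iff.1 hk
  obtain ⟨f, hf, hm⟩ := (Set.toFinite {g : B.E k | x.1 k < g}).exists_minimal ⟨g, hg⟩
  have hcov : x.1 k ⋖ f := ⟨hf, fun c hc hcf => absurd (hm hc hcf.le) (not_le_of_gt hcf)⟩
  have htf : B.t k f = B.t k (x.1 k) := (B.comparable_iff k _ _).1 (Or.inr hcov.le)
  obtain ⟨p, hp, hq⟩ := exists_min_prefix x k f
  refine ⟨⟨fun n => if n ≤ k then p n else x.1 n, fun n => ?_⟩, k, hlt, ?_, ?_, ?_⟩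
  · rcases lt_trichotomy n k with h | h | h
    · have h2 : n + 1 ≤ k := h
      simpa [h.le, h2] using (hq n h).2
    · subst h
      simpa [hp, htf] using x.2 n
    · have h1 : ¬ n ≤ k := by omega
      have h2 : ¬ n + 1 ≤ k := by omega
      simpa [h1, h2] using x.2 n
  · simpa [hp] using hcov
  · intro i hi
    simpa [hi.le] using (hq i hi).1
  · intro i hi
    have h1 : ¬ i ≤ k := by omega
    simp [h1]

open Classical in
/-- The Vershik map `V_B` of a properly ordered diagram. (The path `y` with `IsSucc x y` is
unique; the path of maximal edges is sent to the path of minimal edges.) -/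
noncomputable def vershik (hB : B.ProperlyOrdered) (x : B.Path) : B.Path :=
  if h : AllMax x then hB.2.choose else (exists_succ x h).choose

end OrderedBratteliDiagram

/-- `entranceTime T I k x` is `N_I^{(k)}(x)`: `N^{(0)} = 0` and, for `k ≥ 0`,
`N^{(k+1)}(x) = inf {n > N^{(k)}(x) : T^n x ∈ I}`. -/
noncomputable def entranceTime {X : Type*} (T : X → X) (I : Set X) : ℕ → X → ℕ
  | 0, _ => 0
  | k + 1, x => sInf {n | entranceTime T I k x < n ∧ T^[n] x ∈ I}

/-- For `k ≥ 1`, `entranceLaw T μ I k` is the distribution function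
`F_I^{(k)}(t) = μ {x : μ(I) (N_I^{(k)}(x) - N_I^{(k-1)}(x)) ≤ t}`; for `k = 1` the subtracted term
is `N_I^{(0)} = 0`. -/
noncomputable def entranceLaw {X : Type*} [MeasurableSpace X] (T : X → X) (μ : Measure X)
    (I : Set X) (k : ℕ) (u : ℝ) : ℝ :=
  μ.real {x | μ.real I * ((entranceTime T I k x : ℝ) - (entranceTime T I (k - 1) x : ℝ)) ≤ u}

/-- A stationary ordered Bratteli diagram with vertex sets `V_n = {1, …, m}` for `n ≥ 1`
(labelled here `0, …, m - 1`). `E₁` is the set of edges from the root to `V_1`; all the ordered edge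
sets `E_n`, `n ≥ 2`, are identified with `E`. -/
structure StationaryDiagram (m : ℕ) where
  E₁ : Type
  E : Type
  t₁ : E₁ → Fin m
  s : E → Fin m
  t : E → Fin m
  finE₁ : Fintype E₁
  finE : Fintype E
  nonempty : Nonempty E₁
  t₁_surj : Function.Surjective t₁
  s_surj : Function.Surjective s
  t_surj : Function.Surjective t
  ord₁ : PartialOrder E₁
  ord : PartialOrder E
  comparable_iff₁ : ∀ e f : E₁, (e ≤ f ∨ f ≤ e) ↔ t₁ e = t₁ f
  comparable_iff : ∀ e f : E, (e ≤ f ∨ f ≤ e) ↔ t e = t f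

namespace StationaryDiagram

attribute [instance] ord₁ ord finE₁ finE

variable {m : ℕ} (S : StationaryDiagram m)

/-- The underlying ordered Bratteli diagram. -/
def toDiagram : OrderedBratteliDiagram where
  V := fun n => match n with
    | 0 => Unit
    | _ + 1 => Fin m
  E := fun n => match n with
    | 0 => S.E₁
    | _ + 1 => S.E
  s := fun n => match n with
    | 0 => fun _ => ()
    | _ + 1 => S.s
  t := fun n => match n with
    | 0 => S.t₁
    | _ + 1 => S.t
  finV := fun n => match n with
    | 0 => inferInstanceAs (Finite Unit)
    | _ + 1 => inferInstanceAs (Finite (Fin m))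
  finE := fun n => match n with
    | 0 => inferInstanceAs (Finite S.E₁)
    | _ + 1 => inferInstanceAs (Finite S.E)
  root := ⟨inferInstanceAs (Unique Unit)⟩
  s_surj := fun n => match n with
    | 0 => fun _ => S.nonempty.elim fun e => ⟨e, rfl⟩
    | _ + 1 => S.s_surj
  t_surj := fun n => match n with
    | 0 => S.t₁_surj
    | _ + 1 => S.t_surj
  ord := fun n => match n with
    | 0 => S.ord₁
    | _ + 1 => S.ord
  comparable_iff := fun n => match n with
    | 0 => S.comparable_iff₁
    | _ + 1 => S.comparable_iff

/-- The path space `X_B`. -/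
abbrev X : Type := S.toDiagram.Path

/-- The incidence matrix: `M i j` is the number of edges from `i ∈ V_n` to `j ∈ V_{n+1}`, for any
`n ≥ 1`. -/
noncomputable def M : Matrix (Fin m) (Fin m) ℝ :=
  fun i j => (Nat.card {e : S.E // S.s e = i ∧ S.t e = j} : ℝ)

/-- The incidence matrix has strictly positive coefficients. -/
def H1 : Prop := ∀ i j, 0 < S.M i j

/-- Every vertex of `V_1` receives a unique edge from the root. -/
def H2 : Prop := ∀ i : Fin m, ∃! e : S.E₁, S.t₁ e = i

/-- Every minimal edge starts at the first vertex (for the edges in `E₁` there is nothing to ask). -/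
def H3 [NeZero m] : Prop := ∀ e : S.E, IsMin e → S.s e = 0

variable {S}

/-- The edge of `x` in `E_{k+2}`, i.e. `x_{k+2}`. -/
def edge (x : S.X) (k : ℕ) : S.E := x.1 (k + 1)

/-- The terminal vertex, in `V_{p+1}`, of the edge `x_{p+1}`. -/
def term (x : S.X) (p : ℕ) : Fin m := S.toDiagram.t p (x.1 p)

/-- `n ≥ 1` and the terminal vertex of `x_n` is `v`. -/
def EndsAt (x : S.X) (n : ℕ) (v : Fin m) : Prop := ∃ p, n = p + 1 ∧ term x p = v

/-- The cylinder of the minimal path from the root to `i ∈ V_{p+1}`. -/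
def minCyl (p : ℕ) (i : Fin m) : Set S.X := {y | (∀ q ≤ p, IsMin (y.1 q)) ∧ term y p = i}

variable (S)

/-- `c` is the family of vectors `c(ef)`: for every `n = p + 1 ≥ 1`, every cylinder
`I = [x₁, …, xₙ]` ending at `v`, and every point `z ∈ [I e f]`, the number `c e f i` counts how many
times the trajectory of `z` passes through the minimal path from the root to `i ∈ V_n` before coming
back to `I`. -/
def IsPassageCount (hS : S.toDiagram.ProperlyOrdered) (v : Fin m) (c : S.E → S.E → Fin m → ℕ) :
    Prop :=
  ∀ (p : ℕ) (x : S.X), term x p = v → ∀ z ∈ OrderedBratteliDiagram.cyl x (p + 1),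
    ∀ i : Fin m, c (edge z p) (edge z (p + 1)) i =
      Set.ncard {q : ℕ |
        q < entranceTime (OrderedBratteliDiagram.vershik hS)
          (OrderedBratteliDiagram.cyl x (p + 1)) 1 z ∧
        (OrderedBratteliDiagram.vershik hS)^[q] z ∈ minCyl p i}

/-- `g` assigns to the paths `e₁ … e_{k+1}` the paths `e₁^{(k)} e₂^{(k)}`: for every `n = p + 1 ≥ 1`,
every cylinder `I = [x₁, …, xₙ]` ending at `v`, every `k ≥ 1`, and every `z ∈ [I e₁ … e_{k+1}]`, the
point `V_B^{N_I^{(k-1)}(z)}(z)` belongs to `[I e₁^{(k)} e₂^{(k)}]`. -/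
def IsReturnPath (hS : S.toDiagram.ProperlyOrdered) (v : Fin m)
    (g : ∀ k : ℕ, (Fin (k + 1) → S.E) → S.E × S.E) : Prop :=
  ∀ (p : ℕ) (x : S.X), term x p = v → ∀ z ∈ OrderedBratteliDiagram.cyl x (p + 1),
    ∀ k : ℕ, 1 ≤ k → ∀ w : S.X,
      w = (OrderedBratteliDiagram.vershik hS)^[entranceTime (OrderedBratteliDiagram.vershik hS)
        (OrderedBratteliDiagram.cyl x (p + 1)) (k - 1) z] z →
      w ∈ OrderedBratteliDiagram.cyl x (p + 1) ∧
        g k (fun a => edge z (p + a)) = (edge w p, edge w (p + 1))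

variable {S}

/-- `c̄(ef) = ∑ i, c(ef)(i) l(i)`, for a pair of edges `a = (e, f)`. -/
noncomputable def cbar (c : S.E → S.E → Fin m → ℕ) (l : Fin m → ℝ) (a : S.E × S.E) : ℝ :=
  ∑ i, (c a.1 a.2 i : ℝ) * l i

variable (S) in
open Classical in
/-- The paths `e₁ … e_q` of stationary edges with `s(e₁) = v`, for `q = k + 1`. -/
noncomputable def pathsFrom (v : Fin m) (k : ℕ) : Finset (Fin (k + 1) → S.E) :=
  {e | S.s (e 0) = v ∧ ∀ a : Fin k, S.t (e a.castSucc) = S.s (e a.succ)}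

variable (S) in
open Classical in
/-- The paths `ef` with `s(e) = v`. -/
noncomputable def pairsFrom (v : Fin m) : Finset (S.E × S.E) :=
  {a | S.s a.1 = v ∧ S.t a.1 = S.s a.2}

/-- The finite set `{c_1 < ⋯ < c_L}` of the values `c̄(ef)`, for the paths `ef` with `s(e) = v`. -/
noncomputable def cvals (v : Fin m) (c : S.E → S.E → Fin m → ℕ) (l : Fin m → ℝ) : Finset ℝ :=
  (S.pairsFrom v).image (cbar c l)

/-- `d_0 = 0`, `d_j = c_j r(v)` for `1 ≤ j ≤ L`, and `d_j = ∞` for `j > L`. -/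
noncomputable def d (v : Fin m) (c : S.E → S.E → Fin m → ℕ) (l r : Fin m → ℝ) : ℕ → EReal
  | 0 => 0
  | j + 1 => if h : j < (cvals v c l).card then
      (((cvals v c l).orderEmbOfFin rfl ⟨j, h⟩ * r v : ℝ) : EReal) else ⊤

open Classical in
/-- `Sset v c l j` is `S(j) = {ef : s(e) = v, c̄(ef) = c_j}` for `1 ≤ j ≤ L`, and empty otherwise. -/
noncomputable def Sset (v : Fin m) (c : S.E → S.E → Fin m → ℕ) (l : Fin m → ℝ) :
    ℕ → Finset (S.E × S.E)
  | 0 => ∅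
  | j + 1 => if h : j < (cvals v c l).card then
      {a ∈ S.pairsFrom v | cbar c l a = (cvals v c l).orderEmbOfFin rfl ⟨j, h⟩} else ∅

open Classical in
/-- The formula for `F^{(1)}` on `[d_j, d_{j+1}[`. -/
noncomputable def limitLaw₁ (v : Fin m) (c : S.E → S.E → Fin m → ℕ) (lam : ℝ) (l r : Fin m → ℝ)
    (j : ℕ) (u : ℝ) : ℝ :=
  ∑ a ∈ (Finset.Icc 1 j).biUnion (Sset v c l), cbar c l a * (r (S.t a.2) / lam ^ 2) +
    u / r v * ∑ a ∈ (Finset.Icc (j + 1) (cvals v c l).card).biUnion (Sset v c l),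
      r (S.t a.2) / lam ^ 2

open Classical in
/-- The formula for `F^{(k)}`, `k ≥ 2`, on the interval from `d_j` to `d_{j+1}`. -/
noncomputable def limitLaw (v : Fin m) (c : S.E → S.E → Fin m → ℕ)
    (g : ∀ k : ℕ, (Fin (k + 1) → S.E) → S.E × S.E) (lam : ℝ) (l r : Fin m → ℝ) (k j : ℕ) : ℝ :=
  ∑ e ∈ S.pathsFrom v k with g k e ∈ (Finset.Icc 1 j).biUnion (Sset v c l),
    cbar c l (e 0, e 1) * (r (S.t (e (Fin.last k))) / lam ^ (k + 1))

end StationaryDiagram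

/-!
The Vershik map is a suspension of itself: deleting the edges between the root and the level `n`
maps a path to a path of the same diagram, the rank of the deleted initial segment is the floor on
which the path sits, and the height of the roof over a vertex `i` is the number `h_n(i)` of paths
from the root to `i ∈ V_n`. A cylinder `I` ending at `v ∈ V_n` lies in a single floor, so its visits
are the visits of the base map to the paths starting at `v`. Which towers are crossed between two
such visits depends on the first two edges behind `I` only, and not on `n`; hence the return times
are the sums `∑ i, c(ef)(i) h_n(i)`, where `h_n ∼ λ^(n-1) l` by the Perron-Frobenius theorem. By
invariance the measures of the floors solve `w_n = M w_{n+1}`, whose positive solutions are the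
multiples of `r / λ^(n-1)`; hence `μ(I) = r(v) / λ^(n-1)`. Finally, by Kac's argument, a point
chosen according to `μ` first enters `I` after an excursion from a piece `D ⊆ I` of constant return
time `τ` with probability `τ μ(D)`, and its entrance time is then uniform on `1, …, τ`.
-/

/-! ### Entrance times -/

section EntranceTime

variable {X : Type*} {T : X → X} {I : Set X}

/-- `I` is a sweep-out set for `T`: every forward orbit visits `I` at some positive time. Under this
assumption the infima in `entranceTime` are attained. -/
def IsSweepOut (T : X → X) (I : Set X) : Prop := ∀ x, ∃ n, 0 < n ∧ T^[n] x ∈ I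

/-- The point at which the orbit of `x` enters `I` for the `k`-th time (`x` itself for `k = 0`). -/
noncomputable def entrancePoint (T : X → X) (I : Set X) (k : ℕ) (x : X) : X :=
  T^[entranceTime T I k x] x

theorem entranceTime_lt_succ (hI : IsSweepOut T I) (k : ℕ) (x : X) :
    entranceTime T I k x < entranceTime T I (k + 1) x ∧ entrancePoint T I (k + 1) x ∈ I := by
  obtain ⟨n, hn, hn'⟩ := hI (entrancePoint T I k x)
  exact Nat.sInf_mem (s := {n | entranceTime T I k x < n ∧ T^[n] x ∈ I})
    ⟨n + entranceTime T I k x, by omega, by rwa [Function.iterate_add_apply]⟩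

theorem entrancePoint_succ_mem (hI : IsSweepOut T I) (k : ℕ) (x : X) :
    entrancePoint T I (k + 1) x ∈ I :=
  (entranceTime_lt_succ hI k x).2

theorem entranceTime_one_pos (hI : IsSweepOut T I) (x : X) : 0 < entranceTime T I 1 x :=
  (entranceTime_lt_succ hI 0 x).1

theorem entranceTime_succ_le {k n : ℕ} {x : X} (h : entranceTime T I k x < n) (hn : T^[n] x ∈ I) :
    entranceTime T I (k + 1) x ≤ n :=
  Nat.sInf_le ⟨h, hn⟩

theorem entranceTime_succ_eq {k n : ℕ} {x : X} (h : entranceTime T I k x < n) (hn : T^[n] x ∈ I)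
    (h' : ∀ q, entranceTime T I k x < q → T^[q] x ∈ I → n ≤ q) : entranceTime T I (k + 1) x = n :=
  le_antisymm (entranceTime_succ_le h hn) (le_csInf ⟨n, h, hn⟩ fun q hq => h' q hq.1 hq.2)

theorem entranceTime_one_of_mem {x : X} (h : T x ∈ I) : entranceTime T I 1 x = 1 :=
  entranceTime_succ_eq (k := 0) Nat.one_pos h fun _ hq _ => hq

theorem entranceTime_one_of_notMem (hI : IsSweepOut T I) {x : X} (h : T x ∉ I) :
    entranceTime T I 1 x = entranceTime T I 1 (T x) + 1 := by
  refine entranceTime_succ_eq (k := 0) (Nat.succ_pos _) (entrancePoint_succ_mem hI 0 (T x)) ?_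
  rintro (_ | _ | q) hq hq'
  · exact absurd hq (lt_irrefl _)
  · exact absurd hq' h
  · exact Nat.succ_le_succ (entranceTime_succ_le (k := 0) q.succ_pos hq')

theorem entranceTime_succ (hI : IsSweepOut T I) (k : ℕ) (x : X) :
    entranceTime T I (k + 1) x =
      entranceTime T I k x + entranceTime T I 1 (entrancePoint T I k x) := by
  have hmem := entrancePoint_succ_mem hI 0 (entrancePoint T I k x)
  rw [entrancePoint, entrancePoint, ← Function.iterate_add_apply, zero_add, add_comm] at hmem
  refine entranceTime_succ_eq ?_ hmem fun q hq hq' => ?_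
  · exact Nat.lt_add_of_pos_right (entranceTime_one_pos hI _)
  · obtain ⟨a, rfl⟩ := Nat.exists_eq_add_of_lt hq
    rw [add_assoc, add_comm, Function.iterate_add_apply] at hq'
    exact Nat.add_le_add_left (entranceTime_succ_le (k := 0) a.succ_pos hq') _

theorem entrancePoint_succ (hI : IsSweepOut T I) (k : ℕ) (x : X) :
    entrancePoint T I (k + 1) x = entrancePoint T I 1 (entrancePoint T I k x) := by
  rw [entrancePoint, entranceTime_succ hI, add_comm, Function.iterate_add_apply]
  rfl

theorem entranceTime_succ_eq_add_entrancePoint (hI : IsSweepOut T I) (k : ℕ) (x : X) :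
    entranceTime T I (k + 1) x =
      entranceTime T I 1 x + entranceTime T I k (entrancePoint T I 1 x) := by
  induction k with
  | zero => rfl
  | succ k ih =>
    have hcomp : entrancePoint T I (k + 1) x = entrancePoint T I k (entrancePoint T I 1 x) := by
      rw [entrancePoint, ih, add_comm, Function.iterate_add_apply]
      rfl
    rw [entranceTime_succ hI (k + 1), ih, hcomp, add_assoc, ← entranceTime_succ hI k]

variable [MeasurableSpace X]

theorem measurable_entranceTime (hT : Measurable T) (hI : MeasurableSet I) (hrec : IsSweepOut T I)
    (k : ℕ) : Measurable (entranceTime T I k) := by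
  classical
  induction k with
  | zero => exact measurable_const
  | succ k ih =>
    have hex (x : X) : ∃ n, entranceTime T I k x < n ∧ T^[n] x ∈ I :=
      ⟨_, entranceTime_lt_succ hrec k x⟩
    have heq : entranceTime T I (k + 1) = fun x => Nat.find (hex x) :=
      funext fun x => le_antisymm (Nat.sInf_le (Nat.find_spec (hex x)))
        (Nat.find_min' (hex x) (entranceTime_lt_succ hrec k x))
    rw [heq]
    exact measurable_find hex fun n =>
      (measurableSet_lt ih measurable_const).inter (hT.iterate n hI)

theorem measurable_entrancePoint (hT : Measurable T) (hI : MeasurableSet I)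
    (hrec : IsSweepOut T I) (k : ℕ) : Measurable (entrancePoint T I k) :=
  (measurable_from_prod_countable_right (f := fun x : ℕ × X => T^[x.1] x.2) hT.iterate).comp
    ((measurable_entranceTime hT hI hrec k).prodMk measurable_id)

end EntranceTime

/-! ### Suspensions -/

/-- The system `T` is, via `z ↦ (σ z, ρ z)`, a suspension of the system `T₀` with roof function `H`:
a point moves upwards from the floor `ρ z` above `σ z` until it reaches the roof, and then to the
floor `0` above `T₀ (σ z)`. -/
structure IsSuspension {X Y : Type*} (T : X → X) (T₀ : Y → Y) (σ : X → Y) (ρ : X → ℕ)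
    (H : Y → ℕ) : Prop where
  pos : ∀ y, 0 < H y
  lt : ∀ z, ρ z < H (σ z)
  up : ∀ z, ρ z + 1 < H (σ z) → ρ (T z) = ρ z + 1 ∧ σ (T z) = σ z
  roof : ∀ z, ρ z + 1 = H (σ z) → ρ (T z) = 0 ∧ σ (T z) = T₀ (σ z)

/-- The part of the floor `a` of a suspension that lies above `C`. -/
def suspensionFloor {X Y : Type*} (σ : X → Y) (ρ : X → ℕ) (C : Set Y) (a : ℕ) : Set X :=
  {z | σ z ∈ C ∧ ρ z = a}

namespace IsSuspension

variable {X Y : Type*} {T : X → X} {T₀ : Y → Y} {σ : X → Y} {ρ : X → ℕ} {H : Y → ℕ}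
  {C : Set Y} {a : ℕ} {z : X}

theorem strictMono_birkhoffSum (h : IsSuspension T T₀ σ ρ H) (y : Y) :
    StrictMono (birkhoffSum T₀ H · y) :=
  strictMono_nat_of_lt_succ fun n => by
    rw [birkhoffSum_succ]
    exact Nat.lt_add_of_pos_right (h.pos _)

theorem eq_of_birkhoffSum_add_eq (h : IsSuspension T T₀ σ ρ H) {y : Y} {n k a b : ℕ}
    (ha : a < H (T₀^[n] y)) (hb : b < H (T₀^[k] y))
    (hab : birkhoffSum T₀ H n y + a = birkhoffSum T₀ H k y + b) : n = k ∧ a = b := by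
  have hle {i j : ℕ} (hij : i < j) :
      birkhoffSum T₀ H i y + H (T₀^[i] y) ≤ birkhoffSum T₀ H j y := by
    rw [← birkhoffSum_succ]
    exact (h.strictMono_birkhoffSum y).monotone hij
  rcases lt_trichotomy n k with hnk | rfl | hnk
  · have := hle hnk
    omega
  · exact ⟨rfl, by omega⟩
  · have := hle hnk
    omega

theorem exists_iterate (h : IsSuspension T T₀ σ ρ H) (z : X) (q : ℕ) :
    ∃ n, σ (T^[q] z) = T₀^[n] (σ z) ∧
      birkhoffSum T₀ H n (σ z) + ρ (T^[q] z) = ρ z + q := by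
  induction q with
  | zero => exact ⟨0, rfl, by rw [birkhoffSum_zero, zero_add]; rfl⟩
  | succ q ih =>
    obtain ⟨n, hσ, hρ⟩ := ih
    rw [Function.iterate_succ_apply']
    rcases (Nat.succ_le_of_lt (h.lt (T^[q] z))).lt_or_eq with hlt | heq
    · obtain ⟨hρT, hσT⟩ := h.up _ hlt
      exact ⟨n, hσT.trans hσ, by omega⟩
    · obtain ⟨hρT, hσT⟩ := h.roof _ heq
      refine ⟨n + 1, by rw [hσT, hσ, Function.iterate_succ_apply'], ?_⟩
      rw [birkhoffSum_succ, hρT, ← hσ, ← heq]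
      omega

theorem iterate_eq (h : IsSuspension T T₀ σ ρ H) {q n : ℕ} (ha : a < H (T₀^[n] (σ z)))
    (hq : birkhoffSum T₀ H n (σ z) + a = ρ z + q) :
    σ (T^[q] z) = T₀^[n] (σ z) ∧ ρ (T^[q] z) = a := by
  obtain ⟨k, hσ, hρ⟩ := h.exists_iterate z q
  have hlt := h.lt (T^[q] z)
  rw [hσ] at hlt
  obtain ⟨rfl, rfl⟩ := h.eq_of_birkhoffSum_add_eq ha hlt (by omega)
  exact ⟨hσ, rfl⟩

theorem isSweepOut_floor (h : IsSuspension T T₀ σ ρ H) (hC : IsSweepOut T₀ C)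
    (ha : ∀ y ∈ C, a < H y) : IsSweepOut T (suspensionFloor σ ρ C a) := by
  intro z
  obtain ⟨n, hn, hnC⟩ := hC (σ z)
  have hle : birkhoffSum T₀ H 1 (σ z) ≤ birkhoffSum T₀ H n (σ z) :=
    (h.strictMono_birkhoffSum _).monotone hn
  rw [birkhoffSum_one] at hle
  have hlt := h.lt z
  obtain ⟨hσ, hρ⟩ := h.iterate_eq (q := birkhoffSum T₀ H n (σ z) + a - ρ z) (ha _ hnC) (by omega)
  exact ⟨_, by omega, by rwa [hσ], hρ⟩

theorem entranceTime_floor (h : IsSuspension T T₀ σ ρ H) (hC : IsSweepOut T₀ C)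
    (ha : ∀ y ∈ C, a < H y) (hz : ρ z = a) (k : ℕ) :
    entranceTime T (suspensionFloor σ ρ C a) k z =
      birkhoffSum T₀ H (entranceTime T₀ C k (σ z)) (σ z) := by
  induction k with
  | zero => rw [entranceTime, entranceTime, birkhoffSum_zero]
  | succ k ih =>
    obtain ⟨hlt, hmem⟩ := entranceTime_lt_succ hC k (σ z)
    obtain ⟨hσ, hρ⟩ := h.iterate_eq (z := z)
      (q := birkhoffSum T₀ H (entranceTime T₀ C (k + 1) (σ z)) (σ z)) (ha _ hmem)
      (by rw [hz, add_comm])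
    refine entranceTime_succ_eq (ih ▸ h.strictMono_birkhoffSum _ hlt) ⟨by rwa [hσ], hρ⟩ ?_
    rintro q hq ⟨hqC, hqa⟩
    obtain ⟨n, hσq, hρq⟩ := h.exists_iterate z q
    obtain rfl : q = birkhoffSum T₀ H n (σ z) := by omega
    rw [ih, (h.strictMono_birkhoffSum _).lt_iff_lt] at hq
    rw [hσq] at hqC
    exact (h.strictMono_birkhoffSum _).monotone (entranceTime_succ_le hq hqC)

theorem entrancePoint_floor (h : IsSuspension T T₀ σ ρ H) (hC : IsSweepOut T₀ C)
    (ha : ∀ y ∈ C, a < H y) (hz : z ∈ suspensionFloor σ ρ C a) (k : ℕ) :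
    entrancePoint T (suspensionFloor σ ρ C a) k z ∈ suspensionFloor σ ρ C a ∧
      σ (entrancePoint T (suspensionFloor σ ρ C a) k z) = entrancePoint T₀ C k (σ z) := by
  have hmem : entrancePoint T₀ C k (σ z) ∈ C := by
    cases k with
    | zero => exact hz.1
    | succ k => exact entrancePoint_succ_mem hC k _
  obtain ⟨hσ, hρ⟩ := h.iterate_eq (z := z)
    (q := entranceTime T (suspensionFloor σ ρ C a) k z) (ha _ hmem)
    (by rw [h.entranceTime_floor hC ha hz.2, hz.2, add_comm])
  exact ⟨⟨by rwa [entrancePoint, hσ], hρ⟩, hσ⟩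

theorem exists_birkhoffSum_eq_add_iff (h : IsSuspension T T₀ σ ρ H) {D : Set Y} {y : Y} {n t : ℕ}
    (ht : t < H (T₀^[n] y)) :
    (∃ k, birkhoffSum T₀ H k y = birkhoffSum T₀ H n y + t ∧ T₀^[k] y ∈ D) ↔
      t = 0 ∧ T₀^[n] y ∈ D := by
  constructor
  · rintro ⟨k, hk, hkD⟩
    obtain ⟨rfl, rfl⟩ := h.eq_of_birkhoffSum_add_eq ht (h.pos (T₀^[k] y)) hk.symm
    exact ⟨rfl, hkD⟩
  · rintro ⟨rfl, hnD⟩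
    exact ⟨n, rfl, hnD⟩

open Classical in
theorem count_birkhoffSum (h : IsSuspension T T₀ σ ρ H) (D : Set Y) (y : Y) (n : ℕ) :
    Nat.count (fun t => ∃ k, birkhoffSum T₀ H k y = t ∧ T₀^[k] y ∈ D) (birkhoffSum T₀ H n y) =
      Nat.count (fun k => T₀^[k] y ∈ D) n := by
  induction n with
  | zero => simp only [birkhoffSum_zero, Nat.count_zero]
  | succ n ih =>
    have hcount (p : Prop) {t : ℕ} (ht : 0 < t) :
        Nat.count (fun s => s = 0 ∧ p) t = if p then 1 else 0 := by
      rw [Nat.count_eq_card_filter_range, Finset.filter_and, Finset.filter_eq',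
        if_pos (Finset.mem_range.2 ht), Finset.filter_const]
      split_ifs <;> simp [ht]
    rw [birkhoffSum_succ, Nat.count_add, ih, Nat.count_succ, ← hcount _ (h.pos (T₀^[n] y))]
    congr 1
    simp only [Nat.count_eq_card_filter_range]
    refine congrArg _ (Finset.filter_congr fun t ht => ?_)
    exact h.exists_birkhoffSum_eq_add_iff (Finset.mem_range.1 ht)

theorem ncard_visits (h : IsSuspension T T₀ σ ρ H) (hC : IsSweepOut T₀ C)
    (ha : ∀ y ∈ C, a < H y) (hz : z ∈ suspensionFloor σ ρ C a) {D : Set Y}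
    (hD : σ z ∈ D ↔ entrancePoint T₀ C 1 (σ z) ∈ D) :
    {q | q < entranceTime T (suspensionFloor σ ρ C a) 1 z ∧
      T^[q] z ∈ suspensionFloor σ ρ D 0}.ncard =
    {n | n < entranceTime T₀ C 1 (σ z) ∧ T₀^[n] (σ z) ∈ D}.ncard := by
  classical
  rw [h.entranceTime_floor hC ha hz.2]
  set N := entranceTime T₀ C 1 (σ z)
  set L := birkhoffSum T₀ H N (σ z)
  set V : ℕ → Prop := fun t => ∃ k, birkhoffSum T₀ H k (σ z) = t ∧ T₀^[k] (σ z) ∈ D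
  have hvisit (q : ℕ) : T^[q] z ∈ suspensionFloor σ ρ D 0 ↔ V (a + q) := by
    constructor
    · rintro ⟨hqD, hq0⟩
      obtain ⟨n, hσ, hρ⟩ := h.exists_iterate z q
      exact ⟨n, by rw [← hz.2, ← hρ, hq0, add_zero], by rwa [← hσ]⟩
    · rintro ⟨n, hn, hnD⟩
      obtain ⟨hσ, hρ⟩ := h.iterate_eq (q := q) (h.pos (T₀^[n] (σ z))) (by rw [hn, hz.2, add_zero])
      exact ⟨by rwa [hσ], hρ⟩
  have hperiodic : Nat.count (fun t => V (L + t)) a = Nat.count V a := by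
    simp only [Nat.count_eq_card_filter_range]
    refine congrArg _ (Finset.filter_congr fun t ht => ?_)
    have hN := h.exists_birkhoffSum_eq_add_iff (D := D) (y := σ z) (n := N)
      ((Finset.mem_range.1 ht).trans (ha _ (entrancePoint_succ_mem hC 0 _)))
    have h0 := h.exists_birkhoffSum_eq_add_iff (D := D) (y := σ z) (n := 0)
      ((Finset.mem_range.1 ht).trans (ha _ hz.1))
    rw [birkhoffSum_zero, zero_add] at h0
    exact hN.trans ((and_congr_right fun _ => hD.symm).trans h0.symm)
  have hncard (P : ℕ → Prop) (n : ℕ) : {q | q < n ∧ P q}.ncard = Nat.count P n := by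
    rw [Nat.count_eq_card_filter_range, ← Set.ncard_coe_finset]
    simp
  have hshift := (Nat.count_add V a L).symm.trans ((add_comm a L ▸ Nat.count_add V L a))
  have hbase : Nat.count V L = Nat.count (fun n => T₀^[n] (σ z) ∈ D) N :=
    h.count_birkhoffSum D (σ z) N
  simp only [hncard, hvisit]
  omega

theorem preimage_floor_succ (h : IsSuspension T T₀ σ ρ H) (ha : ∀ y ∈ C, a + 1 < H y) :
    T ⁻¹' suspensionFloor σ ρ C (a + 1) = suspensionFloor σ ρ C a := by
  ext z
  constructor
  · rintro ⟨hC, hρ⟩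
    rcases (Nat.succ_le_of_lt (h.lt z)).lt_or_eq with hlt | heq
    · obtain ⟨hρT, hσT⟩ := h.up z hlt
      exact ⟨hσT ▸ hC, by omega⟩
    · exact absurd hρ (by rw [(h.roof z heq).1]; exact a.succ_ne_zero.symm)
  · rintro ⟨hC, rfl⟩
    obtain ⟨hρT, hσT⟩ := h.up z (ha _ hC)
    exact ⟨by rwa [hσT], hρT⟩

theorem measureReal_floor [MeasurableSpace X] {μ : Measure X} (h : IsSuspension T T₀ σ ρ H)
    (hT : MeasurePreserving T μ μ) (hC : ∀ a, MeasurableSet (suspensionFloor σ ρ C a))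
    (ha : ∀ y ∈ C, a < H y) :
    μ.real (suspensionFloor σ ρ C a) = μ.real (suspensionFloor σ ρ C 0) := by
  induction a with
  | zero => rfl
  | succ a ih =>
    rw [← ih fun y hy => a.lt_succ_self.trans (ha y hy), ← h.preimage_floor_succ ha,
      hT.measureReal_preimage (hC _).nullMeasurableSet]

end IsSuspension

/-! ### The Kac formula -/

section Kac

open Filter Topology
open scoped ENNReal

variable {X : Type*} [MeasurableSpace X] {T : X → X} {μ : Measure X} [IsFiniteMeasure μ]
  {I A : Set X}

theorem tendsto_measureReal_lt_natCast_zero {N : X → ℕ} (hN : Measurable N) :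
    Tendsto (fun q => μ.real {x | q < N x}) atTop (𝓝 0) := by
  have hempty : ⋂ q : ℕ, {x | q < N x} = ∅ :=
    Set.eq_empty_of_forall_notMem fun x hx => lt_irrefl (N x) (Set.mem_iInter.1 hx (N x))
  have hlim := tendsto_measure_iInter_atTop (μ := μ) (s := fun q : ℕ => {x | q < N x})
    (fun q => (measurableSet_lt measurable_const hN).nullMeasurableSet)
    (fun _ _ hij _ hx => hij.trans_lt hx) ⟨0, measure_ne_top _ _⟩
  rw [hempty, measure_empty] at hlim
  exact (ENNReal.tendsto_toReal ENNReal.zero_ne_top).comp hlim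

theorem eq_of_sub_succ_eq_of_tendsto {G : Type*} [AddCommGroup G] [TopologicalSpace G]
    [ContinuousSub G] [T2Space G] {a b : ℕ → G} {L : G}
    (h : ∀ n, a n - a (n + 1) = b n - b (n + 1)) (ha : Tendsto a atTop (𝓝 L))
    (hb : Tendsto b atTop (𝓝 L)) : a = b := by
  have hconst (n : ℕ) : a n - b n = a 0 - b 0 := by
    induction n with
    | zero => rfl
    | succ n ih => rw [← ih, sub_eq_sub_iff_sub_eq_sub, ← neg_sub (a n), h, neg_sub]
  have hzero : a 0 - b 0 = 0 := tendsto_nhds_unique tendsto_const_nhds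
    (by simpa only [hconst, sub_self] using ha.sub hb)
  exact funext fun n => sub_eq_zero.1 ((hconst n).trans hzero)

theorem measureReal_entranceTime_eq_add (hT : MeasurePreserving T μ μ) (hI : MeasurableSet I)
    (hrec : IsSweepOut T I) (hA : MeasurableSet A) (q : ℕ) :
    μ.real {x | entranceTime T I 1 x = q + 1 ∧ entrancePoint T I 1 x ∈ A} =
      μ.real {x | entranceTime T I 1 x = q + 2 ∧ entrancePoint T I 1 x ∈ A} +
        μ.real {x | x ∈ I ∧ entranceTime T I 1 x = q + 1 ∧ entrancePoint T I 1 x ∈ A} := by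
  have hmeas (n : ℕ) :
      MeasurableSet {x | entranceTime T I 1 x = n ∧ entrancePoint T I 1 x ∈ A} :=
    (measurable_entranceTime hT.measurable hI hrec 1 (measurableSet_singleton n)).inter
      (measurable_entrancePoint hT.measurable hI hrec 1 hA)
  have hmeasI : MeasurableSet
      {x | x ∈ I ∧ entranceTime T I 1 x = q + 1 ∧ entrancePoint T I 1 x ∈ A} :=
    hI.inter (hmeas (q + 1))
  rw [← hT.measureReal_preimage (hmeas _).nullMeasurableSet,
    ← hT.measureReal_preimage hmeasI.nullMeasurableSet,
    ← measureReal_union _ (hT.measurable hmeasI)]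
  · congr 1
    ext x
    by_cases hx : T x ∈ I
    · simp [hx, entranceTime_one_of_mem hx]
    · have htime := entranceTime_one_of_notMem hrec hx
      have hpoint : entrancePoint T I 1 x = entrancePoint T I 1 (T x) := by
        rw [entrancePoint, htime]
        rfl
      simp [hx, htime, hpoint]
  · refine Set.disjoint_left.2 fun x hx hx' => ?_
    have := entranceTime_one_of_mem (I := I) (x := x) hx'.1
    have := hx.1
    omega

theorem measureReal_entranceTime_eq (hT : MeasurePreserving T μ μ) (hI : MeasurableSet I)
    (hrec : IsSweepOut T I) (hA : MeasurableSet A) (q : ℕ) :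
    μ.real {x | entranceTime T I 1 x = q + 1 ∧ entrancePoint T I 1 x ∈ A} =
      μ.real {x | x ∈ I ∧ q < entranceTime T I 1 x ∧ entrancePoint T I 1 x ∈ A} := by
  have hN := measurable_entranceTime hT.measurable hI hrec 1
  have hR := measurable_entrancePoint hT.measurable hI hrec 1
  set N := entranceTime T I 1
  set R := entrancePoint T I 1
  set a : ℕ → ℝ := fun q => μ.real {x | N x = q + 1 ∧ R x ∈ A}
  set b : ℕ → ℝ := fun q => μ.real {x | x ∈ I ∧ q < N x ∧ R x ∈ A}
  have ha (q : ℕ) : a q = a (q + 1) + μ.real {x | x ∈ I ∧ N x = q + 1 ∧ R x ∈ A} :=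
    measureReal_entranceTime_eq_add hT hI hrec hA q
  have hb (q : ℕ) : b q = b (q + 1) + μ.real {x | x ∈ I ∧ N x = q + 1 ∧ R x ∈ A} := by
    have hmeas : MeasurableSet {x | x ∈ I ∧ N x = q + 1 ∧ R x ∈ A} :=
      hI.inter ((hN (measurableSet_singleton _)).inter (hR hA))
    rw [← measureReal_union _ hmeas]
    · refine congrArg μ.real (Set.ext fun x => ?_)
      simp only [Set.mem_union, Set.mem_ofPred_eq]
      grind
    · exact Set.disjoint_left.2 fun x hx hx' => (hx.2.1.trans_eq hx'.2.1).false
  have htail := tendsto_measureReal_lt_natCast_zero (μ := μ) hN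
  have ha_lim : Tendsto a atTop (𝓝 0) :=
    squeeze_zero (fun _ => measureReal_nonneg) (fun n => measureReal_mono fun x hx =>
      n.lt_succ_self.trans_eq hx.1.symm) htail
  have hb_lim : Tendsto b atTop (𝓝 0) :=
    squeeze_zero (fun _ => measureReal_nonneg) (fun n => measureReal_mono fun x hx => hx.2.1) htail
  exact congrFun (eq_of_sub_succ_eq_of_tendsto
    (fun n => by rw [ha n, hb n, add_sub_cancel_left, add_sub_cancel_left]) ha_lim hb_lim) q

/-- A form of Kac's lemma: for `f = 1` and `A = I` it reads `μ univ = ∫⁻ x in I, N x ∂μ`. -/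
theorem lintegral_entranceTime (hT : MeasurePreserving T μ μ) (hI : MeasurableSet I)
    (hrec : IsSweepOut T I) (hA : MeasurableSet A) (f : ℕ → ℝ≥0∞) :
    ∫⁻ x in entrancePoint T I 1 ⁻¹' A, f (entranceTime T I 1 x) ∂μ =
      ∫⁻ x in I ∩ entrancePoint T I 1 ⁻¹' A,
        ∑ q ∈ Finset.range (entranceTime T I 1 x), f (q + 1) ∂μ := by
  have hN := measurable_entranceTime hT.measurable hI hrec 1
  have hR := measurable_entrancePoint hT.measurable hI hrec 1
  have hpos := entranceTime_one_pos hrec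
  set N := entranceTime T I 1
  set R := entrancePoint T I 1
  have hlt (q : ℕ) : MeasurableSet {x | q < N x} := measurableSet_lt measurable_const hN
  have hslice (q : ℕ) : μ.restrict (R ⁻¹' A) (N ⁻¹' {q + 1}) =
      μ.restrict (I ∩ R ⁻¹' A) {x | q < N x} := by
    rw [Measure.restrict_apply (hN (measurableSet_singleton _)), Measure.restrict_apply (hlt q),
      ← measureReal_eq_measureReal_iff]
    exact (measureReal_entranceTime_eq hT hI hrec hA q).trans
      (congrArg μ.real (Set.ext fun x => and_left_comm))
  calc ∫⁻ x in R ⁻¹' A, f (N x) ∂μ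
      = ∑' n, f n * μ.restrict (R ⁻¹' A) (N ⁻¹' {n}) := by
        rw [← lintegral_map (measurable_from_nat) hN, lintegral_countable']
        simp only [Measure.map_apply hN (measurableSet_singleton _)]
    _ = ∑' q, f (q + 1) * μ.restrict (I ∩ R ⁻¹' A) {x | q < N x} := by
        have hzero : N ⁻¹' {0} = ∅ := Set.eq_empty_of_forall_notMem fun x hx => (hpos x).ne' hx
        rw [tsum_eq_zero_add' ENNReal.summable, hzero, measure_empty, mul_zero, zero_add]
        simp only [hslice]
    _ = ∫⁻ x in I ∩ R ⁻¹' A, ∑' q, {x | q < N x}.indicator (fun _ => f (q + 1)) x ∂μ := by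
        rw [lintegral_tsum fun q => (measurable_const.indicator (hlt q)).aemeasurable]
        simp only [lintegral_indicator_const (hlt _)]
    _ = ∫⁻ x in I ∩ R ⁻¹' A, ∑ q ∈ Finset.range (N x), f (q + 1) ∂μ := by
        refine lintegral_congr fun x => ?_
        rw [tsum_eq_sum (s := Finset.range (N x)) fun q hq =>
          Set.indicator_of_notMem (s := {x | q < N x}) (fun hx => hq (Finset.mem_range.2 hx)) _]
        exact Finset.sum_congr rfl fun q hq =>
          Set.indicator_of_mem (s := {x | q < N x}) (Finset.mem_range.1 hq) _

/-- A finite measurable partition of `I` into the sets `D e`, `e ∈ P`, on each of which the return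
time to `I` is a constant `τ e`. -/
structure IsReturnPartition {ι : Type*} (T : X → X) (I : Set X) (P : Finset ι) (D : ι → Set X)
    (τ : ι → ℕ) : Prop where
  measurableSet : ∀ e ∈ P, MeasurableSet (D e)
  pairwiseDisjoint : (P : Set ι).PairwiseDisjoint D
  biUnion_eq : ⋃ e ∈ P, D e = I
  entranceTime_eq : ∀ e ∈ P, ∀ x ∈ D e, entranceTime T I 1 x = τ e

namespace IsReturnPartition

variable {ι : Type*} {P : Finset ι} {D : ι → Set X} {τ : ι → ℕ}

theorem lintegral_entranceTime_eq_sum (h : IsReturnPartition T I P D τ)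
    (hT : MeasurePreserving T μ μ) (hrec : IsSweepOut T I) (hA : MeasurableSet A) {Q : ι → Prop}
    [DecidablePred Q] (hQ : ∀ e ∈ P, ∀ x ∈ D e, entrancePoint T I 1 x ∈ A ↔ Q e) (f : ℕ → ℝ≥0∞) :
    ∫⁻ x in entrancePoint T I 1 ⁻¹' A, f (entranceTime T I 1 x) ∂μ =
      ∑ e ∈ P with Q e, (∑ q ∈ Finset.range (τ e), f (q + 1)) * μ (D e) := by
  have hI : MeasurableSet I := h.biUnion_eq ▸ P.measurableSet_biUnion h.measurableSet
  have hunion : I ∩ entrancePoint T I 1 ⁻¹' A = ⋃ e ∈ P.filter Q, D e := by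
    ext x
    have hxI : x ∈ I ↔ ∃ e ∈ P, x ∈ D e := by
      rw [← h.biUnion_eq]
      simp only [Set.mem_iUnion, exists_prop]
    simp only [Set.mem_inter_iff, hxI, Set.mem_iUnion, Finset.mem_filter, exists_prop,
      Set.mem_preimage]
    constructor
    · rintro ⟨⟨e, he, hx⟩, hxA⟩
      exact ⟨e, ⟨he, (hQ e he x hx).1 hxA⟩, hx⟩
    · rintro ⟨e, ⟨he, hQe⟩, hx⟩
      exact ⟨⟨e, he, hx⟩, (hQ e he x hx).2 hQe⟩
  have hmem {e : ι} (he : e ∈ P.filter Q) : e ∈ P := (Finset.mem_filter.1 he).1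
  rw [lintegral_entranceTime hT hI hrec hA, hunion,
    lintegral_biUnion_finset (h.pairwiseDisjoint.subset fun _ he => hmem he)
      fun e he => h.measurableSet e (hmem he)]
  refine Finset.sum_congr rfl fun e he => ?_
  rw [setLIntegral_congr_fun (h.measurableSet e (hmem he)) fun x hx => by
    rw [h.entranceTime_eq e (hmem he) x hx], setLIntegral_const]

theorem measureReal_entranceTime_le (h : IsReturnPartition T I P D τ)
    (hT : MeasurePreserving T μ μ) (hrec : IsSweepOut T I) (u : ℕ) :
    μ.real {x | entranceTime T I 1 x ≤ u} = ∑ e ∈ P, (min (τ e) u : ℕ) * μ.real (D e) := by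
  have hI : MeasurableSet I := h.biUnion_eq ▸ P.measurableSet_biUnion h.measurableSet
  have hcount (n : ℕ) : ∑ q ∈ Finset.range n, (Set.Iic u).indicator (1 : ℕ → ℝ≥0∞) (q + 1) =
      (min n u : ℕ) := by
    induction n with
    | zero => simp
    | succ n ih =>
      rw [Finset.sum_range_succ, ih]
      by_cases hn : n + 1 ≤ u
      · rw [Set.indicator_of_mem (Set.mem_Iic.2 hn), min_eq_left hn, min_eq_left (by omega)]
        simp
      · rw [Set.indicator_of_notMem (by simpa using hn), min_eq_right (by omega),
          min_eq_right (by omega), add_zero]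
  have hsum := h.lintegral_entranceTime_eq_sum (μ := μ) hT hrec MeasurableSet.univ
    (Q := fun _ => True) (fun _ _ _ _ => iff_of_true trivial trivial) ((Set.Iic u).indicator 1)
  simp only [Set.preimage_univ, Measure.restrict_univ, Finset.filter_true, hcount] at hsum
  have hind := lintegral_indicator_one (μ := μ)
    (measurable_entranceTime hT.measurable hI hrec 1 (measurableSet_Iic (a := u)))
  rw [measureReal_def]
  refine (congrArg ENNReal.toReal (hind.symm.trans hsum)).trans ?_
  rw [ENNReal.toReal_sum fun e _ => ENNReal.mul_ne_top (ENNReal.natCast_ne_top _)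
    (measure_ne_top μ _)]
  simp only [ENNReal.toReal_mul, ENNReal.toReal_natCast, measureReal_def]

theorem measureReal_entrancePoint_mem (h : IsReturnPartition T I P D τ)
    (hT : MeasurePreserving T μ μ) (hrec : IsSweepOut T I) (hA : MeasurableSet A) {Q : ι → Prop}
    [DecidablePred Q] (hQ : ∀ e ∈ P, ∀ x ∈ D e, entrancePoint T I 1 x ∈ A ↔ Q e) :
    μ.real (entrancePoint T I 1 ⁻¹' A) = ∑ e ∈ P with Q e, τ e * μ.real (D e) := by
  have hsum := h.lintegral_entranceTime_eq_sum (μ := μ) hT hrec hA hQ 1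
  simp only [Pi.one_apply, lintegral_one, Measure.restrict_apply_univ, Finset.sum_const,
    Finset.card_range, nsmul_one] at hsum
  rw [measureReal_def, hsum, ENNReal.toReal_sum fun e _ => ENNReal.mul_ne_top
    (ENNReal.natCast_ne_top _) (measure_ne_top μ _)]
  simp only [ENNReal.toReal_mul, ENNReal.toReal_natCast, measureReal_def]

theorem entranceLaw_one (h : IsReturnPartition T I P D τ) (hT : MeasurePreserving T μ μ)
    (hrec : IsSweepOut T I) (hI : 0 < μ.real I) {u : ℝ} (hu : 0 ≤ u) :
    entranceLaw T μ I 1 u = ∑ e ∈ P, (min (τ e) ⌊u / μ.real I⌋₊ : ℕ) * μ.real (D e) := by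
  rw [← h.measureReal_entranceTime_le hT hrec, entranceLaw]
  congr 1
  ext y
  rw [Set.mem_ofPred_eq, Set.mem_ofPred_eq, Nat.le_floor_iff (div_nonneg hu hI.le),
    le_div_iff₀' hI, Nat.sub_self, entranceTime.eq_1, Nat.cast_zero, sub_zero]

theorem entranceLaw_add_two (h : IsReturnPartition T I P D τ) (hT : MeasurePreserving T μ μ)
    (hrec : IsSweepOut T I) {k : ℕ} {u : ℝ} {Q : ι → Prop} [DecidablePred Q]
    (hQ : ∀ e ∈ P, ∀ x ∈ D e, μ.real I *
      ((entranceTime T I (k + 2) x : ℝ) - entranceTime T I (k + 1) x) ≤ u ↔ Q e) :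
    entranceLaw T μ I (k + 2) u = ∑ e ∈ P with Q e, τ e * μ.real (D e) := by
  have hI : MeasurableSet I := h.biUnion_eq ▸ P.measurableSet_biUnion h.measurableSet
  have hmeas (n : ℕ) : Measurable fun x => (entranceTime T I n x : ℝ) :=
    measurable_from_top.comp (measurable_entranceTime hT.measurable hI hrec n)
  set A : Set X := {y | μ.real I * ((entranceTime T I (k + 1) y : ℝ) - entranceTime T I k y) ≤ u}
  have hA : MeasurableSet A :=
    measurableSet_le (((hmeas (k + 1)).sub (hmeas k)).const_mul _) measurable_const
  have hshift (x : X) : entrancePoint T I 1 x ∈ A ↔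
      μ.real I * ((entranceTime T I (k + 2) x : ℝ) - entranceTime T I (k + 1) x) ≤ u := by
    rw [entranceTime_succ_eq_add_entrancePoint hrec (k + 1),
      entranceTime_succ_eq_add_entrancePoint hrec k x, Nat.cast_add, Nat.cast_add,
      add_sub_add_left_eq_sub, Set.mem_ofPred_eq]
  rw [← h.measureReal_entrancePoint_mem hT hrec hA fun e he x hx => (hshift x).trans (hQ e he x hx),
    entranceLaw, Nat.add_succ_sub_one]
  exact congrArg μ.real (Set.ext fun x => (hshift x).symm)

end IsReturnPartition

end Kac

/-! ### Positive matrices -/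

section PerronFrobenius

open Filter Topology Matrix

variable {ι : Type*} [Fintype ι]

/-- `M` is a positive matrix, and `r`, `l` are positive right and left eigenvectors of `M` for the
same eigenvalue `lam`, normalized by `l ⬝ᵥ r = 1`. -/
structure IsPerronTriple (M : Matrix ι ι ℝ) (lam : ℝ) (r l : ι → ℝ) : Prop where
  pos : ∀ i j, 0 < M i j
  mulVec_eq : M *ᵥ r = lam • r
  vecMul_eq : l ᵥ* M = lam • l
  right_pos : ∀ i, 0 < r i
  left_pos : ∀ i, 0 < l i
  dotProduct_eq_one : l ⬝ᵥ r = 1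

theorem mulVec_sub_mulVec_le {P : Matrix ι ι ℝ} {δ b : ℝ} (hδ : 0 ≤ δ) (hP : ∀ i j, δ ≤ P i j)
    (hsum : ∀ i, ∑ j, P i j = 1) {w : ι → ℝ} (hw : ∀ i j, w i - w j ≤ b) (i j : ι) :
    (P *ᵥ w) i - (P *ᵥ w) j ≤ (1 - δ) * b := by
  classical
  have hb : 0 ≤ b := by simpa using hw i i
  have hP0 (i j : ι) : 0 ≤ P i j := hδ.trans (hP i j)
  have hdiag : δ ≤ ∑ a, P i a * P j a :=
    calc δ = ∑ a, P i a * δ := by rw [← Finset.sum_mul, hsum, one_mul]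
      _ ≤ _ := Finset.sum_le_sum fun a _ => mul_le_mul_of_nonneg_left (hP j a) (hP0 i a)
  -- two independent steps from `i` and `j` meet with probability at least `δ`
  calc (P *ᵥ w) i - (P *ᵥ w) j
      = ∑ a, ∑ a', P i a * P j a' * (w a - w a') := by
        simp only [mul_sub, Finset.sum_sub_distrib, mul_right_comm _ (P j _) (w _),
          ← Finset.mul_sum, hsum, mul_one, mul_assoc, ← Finset.sum_mul, one_mul]
        simp only [mulVec, dotProduct, mul_comm (w _)]
    _ ≤ ∑ a, ∑ a', (P i a * P j a' - if a = a' then P i a * P j a' else 0) * b := by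
        refine Finset.sum_le_sum fun a _ => Finset.sum_le_sum fun a' _ => ?_
        split_ifs with h
        · simp [h]
        · simpa using mul_le_mul_of_nonneg_left (hw a a') (mul_nonneg (hP0 i a) (hP0 j a'))
    _ = (1 - ∑ a, P i a * P j a) * b := by
        simp [← Finset.sum_mul, Finset.sum_sub_distrib, ← Finset.mul_sum, hsum]
    _ ≤ (1 - δ) * b := by gcongr

namespace IsPerronTriple

variable {M : Matrix ι ι ℝ} {lam : ℝ} {r l : ι → ℝ}

theorem nonempty (h : IsPerronTriple M lam r l) : Nonempty ι := by
  by_contra hι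
  have := not_nonempty_iff.1 hι
  simpa using h.dotProduct_eq_one

theorem eigenvalue_pos (h : IsPerronTriple M lam r l) : 0 < lam := by
  obtain ⟨i⟩ := h.nonempty
  have hi : lam * r i = ∑ j, M i j * r j := (congrFun h.mulVec_eq i).symm
  refine pos_of_mul_pos_left ?_ (h.right_pos i).le
  rw [hi]
  exact Finset.sum_pos (fun j _ => mul_pos (h.pos i j) (h.right_pos j)) ⟨i, Finset.mem_univ i⟩

theorem exists_contraction (h : IsPerronTriple M lam r l) :
    ∃ δ : ℝ, 0 < δ ∧ δ ≤ 1 ∧ ∀ (u : ι → ℝ) (b : ℝ), (∀ i j, u i / r i - u j / r j ≤ b) →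
      ∀ i j, (M *ᵥ u) i / (lam * r i) - (M *ᵥ u) j / (lam * r j) ≤ (1 - δ) * b := by
  have := h.nonempty
  have hlam := h.eigenvalue_pos
  set P : Matrix ι ι ℝ := fun i j => M i j * r j / (lam * r i) with hP
  have hPpos (i j : ι) : 0 < P i j :=
    div_pos (mul_pos (h.pos i j) (h.right_pos j)) (mul_pos hlam (h.right_pos i))
  have hsum (i : ι) : ∑ j, P i j = 1 := by
    have hi : ∑ j, M i j * r j = lam * r i := congrFun h.mulVec_eq i
    rw [hP, ← Finset.sum_div, hi, div_self (mul_pos hlam (h.right_pos i)).ne']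
  obtain ⟨a, ha⟩ := Finite.exists_min fun a : ι × ι => P a.1 a.2
  have hconj (u : ι → ℝ) (i : ι) : (M *ᵥ u) i / (lam * r i) = (P *ᵥ fun j => u j / r j) i := by
    simp only [mulVec, dotProduct, hP, Finset.sum_div]
    refine Finset.sum_congr rfl fun j _ => ?_
    have := (h.right_pos j).ne'
    field_simp
  refine ⟨P a.1 a.2, hPpos _ _, ?_, fun u b hu i j => ?_⟩
  · rw [← hsum a.1]
    exact Finset.single_le_sum (fun j _ => (hPpos a.1 j).le) (Finset.mem_univ a.2)
  · rw [hconj, hconj]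
    exact mulVec_sub_mulVec_le (hPpos _ _).le (fun i j => ha (i, j)) hsum hu i j

section

variable [DecidableEq ι]

theorem vecMul_pow_eq (h : IsPerronTriple M lam r l) (n : ℕ) : l ᵥ* (M ^ n) = lam ^ n • l := by
  induction n with
  | zero => simp
  | succ n ih => rw [pow_succ, ← vecMul_vecMul, ih, smul_vecMul, h.vecMul_eq, smul_smul, pow_succ]

theorem exists_pow_sub_le (h : IsPerronTriple M lam r l) (u : ι → ℝ) :
    ∃ b : ℕ → ℝ, Tendsto b atTop (𝓝 0) ∧ ∀ n i j,
      ((M ^ n) *ᵥ u) i / (lam ^ n * r i) - ((M ^ n) *ᵥ u) j / (lam ^ n * r j) ≤ b n := by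
  obtain ⟨δ, hδ, hδ1, hcontr⟩ := h.exists_contraction
  obtain ⟨C, hC⟩ := (Set.finite_range fun a : ι × ι => u a.1 / r a.1 - u a.2 / r a.2).bddAbove
  refine ⟨fun n => (1 - δ) ^ n * C, ?_, fun n => ?_⟩
  · simpa using (tendsto_pow_atTop_nhds_zero_of_lt_one (sub_nonneg.2 hδ1)
      (sub_lt_self 1 hδ)).mul_const C
  · induction n with
    | zero => simpa using fun i j => hC ⟨(i, j), rfl⟩
    | succ n ih =>
      have := hcontr (fun i => ((M ^ n) *ᵥ u) i / lam ^ n) _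
        (fun i j => by simpa only [div_div] using ih i j)
      have hsmul : (fun i => ((M ^ n) *ᵥ u) i / lam ^ n) = (lam ^ n)⁻¹ • ((M ^ n) *ᵥ u) := by
        funext i
        exact div_eq_inv_mul _ _
      simpa only [hsmul, mulVec_smul, mulVec_mulVec, ← pow_succ', Pi.smul_apply, smul_eq_mul,
        ← div_eq_inv_mul, div_div, ← mul_assoc, ← pow_succ] using this

theorem tendsto_pow_mulVec (h : IsPerronTriple M lam r l) (u : ι → ℝ) (i : ι) :
    Tendsto (fun n => ((M ^ n) *ᵥ u) i / lam ^ n) atTop (𝓝 (r i * (l ⬝ᵥ u))) := by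
  obtain ⟨b, hb, hosc⟩ := h.exists_pow_sub_le u
  set w : ℕ → ι → ℝ := fun n i => ((M ^ n) *ᵥ u) i / (lam ^ n * r i) with hw
  have hpos (j : ι) : 0 ≤ l j * r j := (mul_pos (h.left_pos j) (h.right_pos j)).le
  have hone (c : ℝ) : ∑ j, l j * r j * c = c := by
    rw [← Finset.sum_mul, ← dotProduct, h.dotProduct_eq_one, one_mul]
  -- the mean of `w n` with weights `l j * r j` does not depend on `n`
  have hmean (n : ℕ) : ∑ j, l j * r j * w n j = l ⬝ᵥ u := by
    have hlam := (pow_pos h.eigenvalue_pos n).ne'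
    have hinv : l ⬝ᵥ (M ^ n) *ᵥ u = lam ^ n * (l ⬝ᵥ u) := by
      rw [dotProduct_mulVec, h.vecMul_pow_eq, smul_dotProduct, smul_eq_mul]
    rw [← mul_div_cancel_left₀ (l ⬝ᵥ u) hlam, ← hinv, dotProduct, Finset.sum_div]
    refine Finset.sum_congr rfl fun j _ => ?_
    have := (h.right_pos j).ne'
    simp only [hw]
    field_simp
  have hdist (n : ℕ) : |w n i - l ⬝ᵥ u| ≤ b n := by
    have hsub : w n i - l ⬝ᵥ u = ∑ j, l j * r j * (w n i - w n j) := by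
      simp only [mul_sub, Finset.sum_sub_distrib, hone, hmean]
    rw [hsub, ← hone (b n)]
    refine (Finset.abs_sum_le_sum_abs _ _).trans (Finset.sum_le_sum fun j _ => ?_)
    rw [abs_mul, abs_of_nonneg (hpos j)]
    exact mul_le_mul_of_nonneg_left (abs_sub_le_iff.2 ⟨hosc n i j, hosc n j i⟩) (hpos j)
  have hlim : Tendsto (fun n => w n i) atTop (𝓝 (l ⬝ᵥ u)) :=
    tendsto_iff_norm_sub_tendsto_zero.2 (squeeze_zero (fun _ => norm_nonneg _) hdist hb)
  refine (hlim.const_mul (r i)).congr fun n => ?_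
  have := (h.right_pos i).ne'
  simp only [hw]
  field_simp

theorem tendsto_pow (h : IsPerronTriple M lam r l) (i j : ι) :
    Tendsto (fun n => (M ^ n) i j / lam ^ n) atTop (𝓝 (r i * l j)) := by
  simpa using h.tendsto_pow_mulVec (Pi.single j 1) i

end

theorem tendsto_of_eq_vecMul (h : IsPerronTriple M lam r l) {f : ℕ → ι → ℝ}
    (hf : ∀ n, f (n + 1) = f n ᵥ* M) (i : ι) :
    Tendsto (fun n => f n i / lam ^ n) atTop (𝓝 ((f 0 ⬝ᵥ r) * l i)) := by
  classical
  have hpow (n : ℕ) : f n = f 0 ᵥ* M ^ n := by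
    induction n with
    | zero => simp
    | succ n ih => rw [hf, ih, vecMul_vecMul, pow_succ]
  have hlim := tendsto_finsetSum Finset.univ fun j _ => (h.tendsto_pow j i).const_mul (f 0 j)
  simp only [← mul_assoc, ← Finset.sum_mul] at hlim
  refine hlim.congr fun n => ?_
  rw [hpow n]
  simp only [vecMul, dotProduct, Finset.sum_div, mul_div_assoc]

theorem eq_of_eq_mulVec_succ (h : IsPerronTriple M lam r l) {f : ℕ → ι → ℝ}
    (hf : ∀ n, f n = M *ᵥ f (n + 1)) (hf0 : ∀ n i, 0 ≤ f n i) (n : ℕ) (i : ι) :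
    f n i = (l ⬝ᵥ f 0) * r i / lam ^ n := by
  classical
  have hpow (n q : ℕ) : f n = (M ^ q) *ᵥ f (n + q) := by
    induction q with
    | zero => simp
    | succ q ih => rw [ih, hf (n + q), mulVec_mulVec, ← pow_succ, add_assoc]
  have hmass (n q : ℕ) : l ⬝ᵥ f n = lam ^ q * (l ⬝ᵥ f (n + q)) := by
    rw [hpow n q, dotProduct_mulVec, h.vecMul_pow_eq, smul_dotProduct, smul_eq_mul]
  have hlam := h.eigenvalue_pos
  have hbound (q : ℕ) (j : ι) : lam ^ q * f (n + q) j ≤ (l ⬝ᵥ f n) / l j := by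
    rw [le_div_iff₀' (h.left_pos j), hmass n q, mul_left_comm]
    exact mul_le_mul_of_nonneg_left (Finset.single_le_sum (f := fun j => l j * f (n + q) j)
      (fun j _ => mul_nonneg (h.left_pos j).le (hf0 _ j)) (Finset.mem_univ j)) (pow_pos hlam q).le
  have hlim : Tendsto (fun q => ∑ j, ((M ^ q) i j / lam ^ q - r i * l j) *
      (lam ^ q * f (n + q) j)) atTop (𝓝 (∑ _j : ι, 0)) := by
    refine tendsto_finsetSum _ fun j _ => ?_
    refine (tendsto_sub_nhds_zero_iff.2 (h.tendsto_pow i j)).zero_mul_isBoundedUnder_le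
      (isBoundedUnder_of ⟨(l ⬝ᵥ f n) / l j, fun q => ?_⟩)
    simpa [abs_of_nonneg, hf0, hlam.le] using hbound q j
  have hconst (q : ℕ) : ∑ j, ((M ^ q) i j / lam ^ q - r i * l j) * (lam ^ q * f (n + q) j) =
      f n i - r i * (l ⬝ᵥ f n) := by
    rw [hmass n q, congrFun (hpow n q) i, mulVec, dotProduct, dotProduct, Finset.mul_sum,
      Finset.mul_sum, ← Finset.sum_sub_distrib]
    refine Finset.sum_congr rfl fun j _ => ?_
    field_simp
  simp only [hconst, Finset.sum_const_zero, tendsto_const_nhds_iff, sub_eq_zero] at hlim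
  rw [hlim, hmass 0 n, zero_add]
  field_simp

end IsPerronTriple

end PerronFrobenius

/-! ### Uniform convergence of piecewise constant functions -/

section UniformConvergence

open Filter Topology

variable {ι : Type*} {F : Filter ι}

theorem tendstoUniformlyOn_finsetSum {κ α β : Type*} [AddCommGroup β] [UniformSpace β]
    [IsUniformAddGroup β] {A : Set α} (s : Finset κ) {f : κ → ι → α → β} {g : κ → α → β}
    (h : ∀ a ∈ s, TendstoUniformlyOn (f a) (g a) F A) :
    TendstoUniformlyOn (fun i u => ∑ a ∈ s, f a i u) (fun u => ∑ a ∈ s, g a u) F A := by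
  classical
  induction s using Finset.induction_on with
  | empty => exact fun U hU => Eventually.of_forall fun _ _ _ => refl_mem_uniformity hU
  | insert a s ha ih =>
    simp only [Finset.sum_insert ha]
    exact (h a (Finset.mem_insert_self a s)).add
      (ih fun b hb => h b (Finset.mem_insert_of_mem hb))

theorem abs_natFloor_mul_div_sub_le {u L : ℝ} (hu : 0 ≤ u) (hL : 0 < L) :
    |(⌊u * L⌋₊ : ℝ) / L - u| ≤ L⁻¹ := by
  have hfloor := Nat.floor_le (mul_nonneg hu hL.le)
  have hlt := (Nat.lt_floor_add_one (u * L)).le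
  rw [div_sub' hL.ne', abs_div, abs_of_pos hL, ← one_div, mul_comm L u]
  exact div_le_div_of_nonneg_right (abs_le.2 ⟨by linarith, by linarith⟩) hL.le

theorem tendstoUniformlyOn_min_natFloor {w L : ι → ℝ} {b : ℝ} (hw : Tendsto w F (𝓝 b))
    (hL : Tendsto L F atTop) :
    TendstoUniformlyOn (fun i u => min (w i) ((⌊u * L i⌋₊ : ℝ) / L i)) (fun u => min b u) F
      (Set.Ici 0) := by
  rw [Metric.tendstoUniformlyOn_iff]
  intro ε hε
  filter_upwards [Metric.tendsto_nhds.1 hw ε hε, hL.eventually_gt_atTop 0,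
    hL.inv_tendsto_atTop.eventually (gt_mem_nhds hε)] with i hwi hpos hinv u hu
  rw [dist_comm]
  exact (abs_min_sub_min_le_max _ _ _ _).trans_lt
    (max_lt hwi ((abs_natFloor_mul_div_sub_le hu hpos).trans_lt hinv))

theorem eventually_forall_le_iff_le {α : Type*} [LinearOrder α] [TopologicalSpace α]
    [OrderTopology α] {w : ι → α} {b : α} (hw : Tendsto w F (𝓝 b)) {K : Set α} (hK : IsClosed K)
    (hb : b ∉ K) : ∀ᶠ i in F, ∀ u ∈ K, w i ≤ u ↔ b ≤ u := by
  obtain ⟨c, d, hbcd, hnhds, hsub⟩ :=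
    exists_Icc_mem_subset_of_mem_nhds (hK.isOpen_compl.mem_nhds hb)
  filter_upwards [hw.eventually hnhds] with i hi u hu
  have hout : u < c ∨ d < u := by
    by_contra! h
    exact hsub h hu
  rcases hout with h | h
  · exact iff_of_false (h.trans_le hi.1).not_ge (h.trans_le hbcd.1).not_ge
  · exact iff_of_true (hi.2.trans h.le) (hbcd.2.trans h.le)

end UniformConvergence

namespace StationaryDiagram

open OrderedBratteliDiagram (vershik cyl exists_succ AllMax AllMin)
open Filter Topology
open scoped Matrix

variable {m : ℕ} {S : StationaryDiagram m}

/-! ### Paths and edges of a stationary diagram -/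

section Paths

theorem term_eq_source (z : S.X) (k : ℕ) : term z k = S.s (edge z k) := z.2 k

theorem target_edge (z : S.X) (k : ℕ) : S.t (edge z k) = S.s (edge z (k + 1)) := z.2 (k + 1)

theorem first_edge_eq (h2 : S.H2) {z w : S.X} (h : term z 0 = term w 0) : z.1 0 = w.1 0 :=
  (h2 (term w 0)).unique h rfl

theorem isMin_first_edge (h2 : S.H2) (z : S.X) : IsMin (z.1 0) := fun e he =>
  have ht : S.t₁ e = S.t₁ (z.1 0) := (S.comparable_iff₁ e (z.1 0)).1 (Or.inl he)
  ((h2 _).unique ht rfl).ge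

theorem allMin_of_edge (h2 : S.H2) {z : S.X} (h : ∀ k, IsMin (edge z k)) : AllMin z
  | 0 => isMin_first_edge h2 z
  | k + 1 => h k

theorem path_ext (h2 : S.H2) {z w : S.X} (h : ∀ k, edge z k = edge w k) : z = w := by
  refine Subtype.ext (funext fun n => ?_)
  cases n with
  | zero => exact first_edge_eq h2 (by rw [term_eq_source, term_eq_source, h])
  | succ k => exact h k

/-- The path with a given sequence of stationary edges. -/
noncomputable def ofEdges (h2 : S.H2) (f : ℕ → S.E) (hf : ∀ k, S.t (f k) = S.s (f (k + 1))) : S.X :=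
  ⟨fun n => match n with
    | 0 => (h2 (S.s (f 0))).choose
    | k + 1 => f k, fun n => match n with
    | 0 => (h2 (S.s (f 0))).choose_spec.1
    | k + 1 => hf k⟩

/-- The path obtained by forgetting the edges between the root and the level `p + 1`. By
stationarity it is again a path of the diagram. -/
noncomputable def tail (h2 : S.H2) (p : ℕ) (z : S.X) : S.X :=
  ofEdges h2 (fun k => edge z (p + k)) fun k => target_edge z (p + k)

theorem edge_tail (h2 : S.H2) (p : ℕ) (z : S.X) (k : ℕ) :
    edge (tail h2 p z) k = edge z (p + k) := rfl

theorem term_tail (h2 : S.H2) (p : ℕ) (z : S.X) (k : ℕ) :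
    term (tail h2 p z) k = term z (p + k) := by
  rw [term_eq_source, term_eq_source, edge_tail]

end Paths

section EdgeOrder

theorem target_eq_of_le {e f : S.E} (h : e ≤ f) : S.t e = S.t f :=
  (S.comparable_iff e f).1 (Or.inl h)

theorem le_or_lt_of_target_eq {e f : S.E} (h : S.t e = S.t f) : e ≤ f ∨ f < e :=
  ((S.comparable_iff e f).2 h).elim Or.inl fun hfe => hfe.eq_or_lt.imp Eq.ge id

theorem le_of_lt_of_covBy {e f g : S.E} (h : e ⋖ f) (hg : g < f) : g ≤ e :=
  have ht : S.t g = S.t e := (target_eq_of_le hg.le).trans (target_eq_of_le h.le).symm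
  (le_or_lt_of_target_eq ht).resolve_right fun heg => h.2 heg hg

theorem le_of_isMax {e f : S.E} (h : IsMax e) (ht : S.t f = S.t e) : f ≤ e :=
  (le_or_lt_of_target_eq ht).resolve_right h.not_lt

end EdgeOrder

/-! ### Ranks of finite paths -/

section Rank

variable (S) in
open Classical in
/-- The height of the tower over a vertex: `hgt S p i` is the number of paths from the root to
`i ∈ V_{p+1}`. -/
noncomputable def hgt : ℕ → Fin m → ℕ
  | 0, _ => 1
  | p + 1, j => ∑ e : S.E with S.t e = j, hgt p (S.s e)

open Classical in
/-- The number of paths from the root to `V_{p+2}` whose last edge is below `e`. -/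
noncomputable def edgeOffset (p : ℕ) (e : S.E) : ℕ := ∑ g : S.E with g < e, hgt S p (S.s g)

/-- The rank of the initial segment of `z` of length `p + 1` among the paths with the same end. -/
noncomputable def rank : ℕ → S.X → ℕ
  | 0, _ => 0
  | p + 1, z => rank p z + edgeOffset p (edge z p)

theorem hgt_pos (p : ℕ) (i : Fin m) : 0 < hgt S p i := by
  induction p generalizing i with
  | zero => exact one_pos
  | succ p ih =>
    obtain ⟨e, he⟩ := S.t_surj i
    exact Finset.sum_pos (fun e _ => ih _) ⟨e, by simp [he]⟩

open Classical in
theorem edgeOffset_add_hgt (p : ℕ) (e : S.E) :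
    edgeOffset p e + hgt S p (S.s e) = ∑ g : S.E with g ≤ e, hgt S p (S.s g) := by
  have h : (Finset.univ.filter (· ≤ e) : Finset S.E) = insert e (Finset.univ.filter (· < e)) := by
    ext g
    simp [le_iff_eq_or_lt]
  rw [h, Finset.sum_insert (by simp), add_comm, edgeOffset]

theorem edgeOffset_add_hgt_le_of_lt (p : ℕ) {e f : S.E} (h : e < f) :
    edgeOffset p e + hgt S p (S.s e) ≤ edgeOffset p f := by
  classical
  rw [edgeOffset_add_hgt]
  exact Finset.sum_le_sum_of_subset
    (Finset.monotone_filter_right _ fun _ _ hg => lt_of_le_of_lt hg h)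

theorem edgeOffset_of_covBy (p : ℕ) {e f : S.E} (h : e ⋖ f) :
    edgeOffset p f = edgeOffset p e + hgt S p (S.s e) := by
  rw [edgeOffset_add_hgt, edgeOffset]
  congr 1
  ext g
  simpa using ⟨le_of_lt_of_covBy h, fun hg => hg.trans_lt h.1⟩

theorem edgeOffset_add_hgt_le (p : ℕ) (e : S.E) :
    edgeOffset p e + hgt S p (S.s e) ≤ hgt S (p + 1) (S.t e) := by
  classical
  rw [edgeOffset_add_hgt, hgt]
  exact Finset.sum_le_sum_of_subset
    (Finset.monotone_filter_right _ fun _ _ hg => target_eq_of_le hg)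

theorem edgeOffset_add_hgt_eq_iff (p : ℕ) (e : S.E) :
    edgeOffset p e + hgt S p (S.s e) = hgt S (p + 1) (S.t e) ↔ IsMax e := by
  constructor
  · refine fun h => isMax_iff_forall_not_lt.2 fun f hef => ?_
    have h1 := edgeOffset_add_hgt_le_of_lt p hef
    have h2 := edgeOffset_add_hgt_le p f
    have h3 := hgt_pos (S := S) p (S.s f)
    rw [target_eq_of_le hef.le] at h
    omega
  · intro h
    rw [edgeOffset_add_hgt, hgt]
    congr 1
    ext g
    simpa using ⟨target_eq_of_le, le_of_isMax h⟩

theorem edgeOffset_eq_zero_iff (p : ℕ) (e : S.E) : edgeOffset p e = 0 ↔ IsMin e := by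
  simp [edgeOffset, Finset.sum_eq_zero_iff, isMin_iff_forall_not_lt, (hgt_pos p _).ne']

theorem eq_of_add_edgeOffset_eq (p : ℕ) {e f : S.E} (ht : S.t e = S.t f) {a b : ℕ}
    (ha : a < hgt S p (S.s e)) (hb : b < hgt S p (S.s f))
    (h : a + edgeOffset p e = b + edgeOffset p f) : e = f := by
  rcases le_or_lt_of_target_eq ht with hef | hfe
  · refine hef.eq_or_lt.resolve_right fun hlt => ?_
    have := edgeOffset_add_hgt_le_of_lt p hlt
    omega
  · have := edgeOffset_add_hgt_le_of_lt p hfe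
    omega

theorem rank_lt (p : ℕ) (z : S.X) : rank p z < hgt S p (term z p) := by
  induction p with
  | zero => exact one_pos
  | succ p ih =>
    rw [term_eq_source] at ih
    have := edgeOffset_add_hgt_le p (edge z p)
    change rank p z + edgeOffset p (edge z p) < hgt S (p + 1) (S.t (edge z p))
    omega

theorem rank_eq_zero_iff {p : ℕ} {z : S.X} : rank p z = 0 ↔ ∀ i < p, IsMin (edge z i) := by
  induction p with
  | zero => simp [rank]
  | succ p ih =>
    rw [rank, Nat.add_eq_zero_iff, ih, edgeOffset_eq_zero_iff, Nat.forall_lt_succ_right]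

theorem rank_add_one_eq_iff {p : ℕ} {z : S.X} :
    rank p z + 1 = hgt S p (term z p) ↔ ∀ i < p, IsMax (edge z i) := by
  induction p with
  | zero => simp [rank, hgt]
  | succ p ih =>
    have h1 := rank_lt p z
    have h2 := edgeOffset_add_hgt_le p (edge z p)
    rw [Nat.forall_lt_succ_right, ← ih, ← edgeOffset_add_hgt_eq_iff p]
    rw [term_eq_source z p] at h1 ⊢
    change rank p z + edgeOffset p (edge z p) + 1 = hgt S (p + 1) (S.t (edge z p)) ↔ _
    omega

theorem rank_congr {p : ℕ} {z w : S.X} (h : ∀ i < p, edge z i = edge w i) :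
    rank p z = rank p w := by
  induction p with
  | zero => rfl
  | succ p ih => rw [rank, rank, ih fun i hi => h i (by omega), h p (by omega)]

theorem rank_succ_eq_iff {p a : ℕ} {e : S.E} (ha : a < hgt S p (S.s e)) {z : S.X} :
    term z (p + 1) = S.t e ∧ rank (p + 1) z = a + edgeOffset p e ↔ edge z p = e ∧ rank p z = a := by
  constructor
  · rintro ⟨ht, hrank⟩
    have hlt := rank_lt p z
    rw [term_eq_source] at hlt
    obtain rfl : edge z p = e := eq_of_add_edgeOffset_eq p ht hlt ha hrank
    exact ⟨rfl, Nat.add_right_cancel hrank⟩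
  · rintro ⟨rfl, rfl⟩
    exact ⟨rfl, rfl⟩

theorem edge_eq_of_rank_eq {p : ℕ} {z w : S.X} (ht : term z p = term w p)
    (h : rank p z = rank p w) : ∀ i < p, edge z i = edge w i := by
  induction p with
  | zero => simp
  | succ p ih =>
    have hw := rank_lt p w
    rw [term_eq_source] at hw
    obtain ⟨hedge, hrank⟩ := (rank_succ_eq_iff hw).1 ⟨ht, h⟩
    refine Nat.forall_lt_succ_right.2 ⟨ih ?_ hrank, hedge⟩
    rw [term_eq_source, term_eq_source, hedge]

end Rank

/-! ### The Vershik map as a suspension of itself -/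

section Vershik

/-- The graph of the Vershik map in terms of the stationary edges alone: under `H2` the edges in
`E₁` are both minimal and maximal. -/
def IsEdgeSucc (z w : S.X) : Prop :=
  ((∀ k, IsMax (edge z k)) ∧ ∀ k, IsMin (edge w k)) ∨
    ∃ k, (∀ i < k, IsMax (edge z i)) ∧ edge z k ⋖ edge w k ∧ (∀ i < k, IsMin (edge w i)) ∧
      ∀ i, k < i → edge w i = edge z i

theorem isEdgeSucc_vershik (hS : S.toDiagram.ProperlyOrdered) (h2 : S.H2) (z : S.X) :
    IsEdgeSucc z (vershik hS z) := by
  by_cases h : AllMax z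
  · have hv : vershik hS z = hS.2.choose := dif_pos h
    rw [hv]
    exact Or.inl ⟨fun k => h (k + 1), fun k => hS.2.choose_spec.1 (k + 1)⟩
  · have hv : vershik hS z = (exists_succ z h).choose := dif_neg h
    obtain ⟨k, hmax, hcov, hmin, hafter⟩ := (exists_succ z h).choose_spec
    rw [← hv] at hcov hmin hafter
    cases k with
    | zero =>
      have ht : term z 0 = term (vershik hS z) 0 :=
        (S.toDiagram.comparable_iff 0 _ _).1 (Or.inl hcov.le)
      exact absurd (first_edge_eq h2 ht) hcov.1.ne
    | succ k =>
      exact Or.inr ⟨k, fun i hi => hmax (i + 1) (by omega), hcov,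
        fun i hi => hmin (i + 1) (by omega), fun i hi => hafter (i + 1) (by omega)⟩

namespace IsEdgeSucc

variable {z w : S.X} {p : ℕ}

theorem isMin (h : IsEdgeSucc z w) (hz : ∀ i < p, IsMax (edge z i)) :
    ∀ i < p, IsMin (edge w i) := by
  rcases h with ⟨-, hmin⟩ | ⟨k, -, hcov, hmin, -⟩
  · exact fun i _ => hmin i
  · have hpk : p ≤ k := not_lt.1 fun hlt => (hz k hlt).not_lt hcov.1
    exact fun i hi => hmin i (by omega)

theorem exists_covBy (h : IsEdgeSucc z w) (hz : ∃ i < p, ¬ IsMax (edge z i)) :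
    ∃ k < p, (∀ i < k, IsMax (edge z i)) ∧ edge z k ⋖ edge w k ∧ (∀ i < k, IsMin (edge w i)) ∧
      ∀ i, k < i → edge w i = edge z i := by
  obtain ⟨i, hi, hmax⟩ := hz
  rcases h with ⟨hz, -⟩ | ⟨k, hz, hk⟩
  · exact absurd (hz i) hmax
  · exact ⟨k, lt_of_le_of_lt (not_lt.1 fun hlt => hmax (hz i hlt)) hi, hz, hk⟩

theorem rank_eq (h : IsEdgeSucc z w) (hz : ∃ i < p, ¬ IsMax (edge z i)) :
    rank p w = rank p z + 1 ∧ ∀ i, p ≤ i → edge w i = edge z i := by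
  obtain ⟨k, hk, hmax, hcov, hmin, hafter⟩ := h.exists_covBy hz
  refine ⟨?_, fun i hi => hafter i (by omega)⟩
  induction p, hk using Nat.le_induction with
  | base =>
    have hrank := rank_add_one_eq_iff.2 hmax
    rw [term_eq_source] at hrank
    rw [rank, rank, rank_eq_zero_iff.2 hmin, edgeOffset_of_covBy k hcov]
    omega
  | succ p hp ih =>
    rw [rank, rank, ih ⟨k, hp, fun hkmax => hkmax.not_lt hcov.1⟩, hafter p hp]
    omega

theorem unique (hS : S.toDiagram.ProperlyOrdered) (h2 : S.H2) {w₁ w₂ : S.X}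
    (hw₁ : IsEdgeSucc z w₁) (hw₂ : IsEdgeSucc z w₂) : w₁ = w₂ := by
  by_cases hz : ∀ k, IsMax (edge z k)
  · exact hS.2.unique (allMin_of_edge h2 fun k => hw₁.isMin (fun i _ => hz i) k k.lt_succ_self)
      (allMin_of_edge h2 fun k => hw₂.isMin (fun i _ => hz i) k k.lt_succ_self)
  · obtain ⟨p, hp⟩ := not_forall.1 hz
    obtain ⟨hr₁, hafter₁⟩ := hw₁.rank_eq ⟨p, p.lt_succ_self, hp⟩
    obtain ⟨hr₂, hafter₂⟩ := hw₂.rank_eq ⟨p, p.lt_succ_self, hp⟩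
    have hafter : ∀ i, p + 1 ≤ i → edge w₁ i = edge w₂ i :=
      fun i hi => (hafter₁ i hi).trans (hafter₂ i hi).symm
    have hterm : term w₁ (p + 1) = term w₂ (p + 1) := by
      rw [term_eq_source, term_eq_source, hafter _ le_rfl]
    refine path_ext h2 fun i => (lt_or_ge i (p + 1)).elim ?_ (hafter i)
    exact edge_eq_of_rank_eq hterm (hr₁.trans hr₂.symm) i

theorem tail (h : IsEdgeSucc z w) (h2 : S.H2) (hz : ∀ i < p, IsMax (edge z i)) :
    IsEdgeSucc (tail h2 p z) (tail h2 p w) := by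
  rcases h with ⟨hmax, hmin⟩ | ⟨k, hmax, hcov, hmin, hafter⟩
  · exact Or.inl ⟨fun k => hmax (p + k), fun k => hmin (p + k)⟩
  · obtain ⟨a, rfl⟩ := Nat.exists_eq_add_of_le (not_lt.1 fun hlt => (hz k hlt).not_lt hcov.1)
    exact Or.inr ⟨a, fun i hi => hmax (p + i) (by omega), hcov,
      fun i hi => hmin (p + i) (by omega), fun i hi => hafter (p + i) (by omega)⟩

end IsEdgeSucc

variable {hS : S.toDiagram.ProperlyOrdered}

theorem isSuspension_tail (h2 : S.H2) (p : ℕ) :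
    IsSuspension (vershik hS) (vershik hS) (tail h2 p) (rank p)
      (fun y => hgt S p (term y 0)) where
  pos y := hgt_pos p _
  lt z := by
    rw [term_tail]
    exact rank_lt p z
  up z hz := by
    rw [term_tail] at hz
    have hmax : ∃ i < p, ¬ IsMax (edge z i) := by
      simpa using mt rank_add_one_eq_iff.2 hz.ne
    obtain ⟨hrank, hafter⟩ := (isEdgeSucc_vershik hS h2 z).rank_eq hmax
    exact ⟨hrank, path_ext h2 fun k => hafter (p + k) (by omega)⟩
  roof z hz := by
    rw [term_tail] at hz
    have hmax := rank_add_one_eq_iff.1 hz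
    have hsucc := isEdgeSucc_vershik hS h2 z
    exact ⟨rank_eq_zero_iff.2 (hsucc.isMin hmax),
      (hsucc.tail h2 hmax).unique hS h2 (isEdgeSucc_vershik hS h2 _)⟩

variable (S) in
/-- The paths `y` whose first vertex, in `V_1`, is `v`. -/
def startSet (v : Fin m) : Set S.X := {y | term y 0 = v}

theorem tail_mem_startSet (h2 : S.H2) {p : ℕ} {v : Fin m} {z : S.X} :
    tail h2 p z ∈ S.startSet v ↔ term z p = v := by
  rw [startSet, Set.mem_ofPred_eq, term_tail, Nat.add_zero]

theorem cyl_eq (h2 : S.H2) (x : S.X) (p : ℕ) :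
    cyl x (p + 1) = suspensionFloor (tail h2 p) (rank p) (S.startSet (term x p)) (rank p x) := by
  ext z
  refine Iff.trans ?_ (and_congr_left' (tail_mem_startSet h2)).symm
  constructor
  · exact fun h => ⟨congrArg (S.toDiagram.t p) (h p p.lt_succ_self),
      rank_congr fun i hi => h (i + 1) (by omega)⟩
  · rintro ⟨hterm, hrank⟩ i hi
    have hedge := edge_eq_of_rank_eq hterm hrank
    cases i with
    | succ i => exact hedge i (by omega)
    | zero =>
      apply first_edge_eq h2
      cases p with
      | zero => exact hterm
      | succ p => rw [term_eq_source, term_eq_source, hedge 0 p.succ_pos]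

theorem minCyl_eq (h2 : S.H2) (p : ℕ) (i : Fin m) :
    minCyl p i = suspensionFloor (tail h2 p) (rank p) (S.startSet i) 0 := by
  ext z
  refine Iff.trans ?_ (and_congr (tail_mem_startSet h2) rank_eq_zero_iff).symm
  constructor
  · exact fun ⟨hmin, hterm⟩ => ⟨hterm, fun i hi => hmin (i + 1) (by omega)⟩
  · refine fun ⟨hterm, hmin⟩ => ⟨fun q hq => ?_, hterm⟩
    cases q with
    | zero => exact isMin_first_edge h2 z
    | succ q => exact hmin q (by omega)

end Vershik

/-! ### Returns to a cylinder -/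

section Returns

variable {hS : S.toDiagram.ProperlyOrdered} {v : Fin m} {p : ℕ} {y z : S.X}

theorem exists_edge (h1 : S.H1) (i j : Fin m) : ∃ e : S.E, S.s e = i ∧ S.t e = j := by
  have h := h1 i j
  rw [M, Nat.cast_pos, Nat.card_pos_iff] at h
  exact h.1.elim fun e => ⟨e.1, e.2⟩

-- The orbit of `y` runs through all the paths to the second vertex of `V (tail 1 y)`, and one of
-- these starts at `v`.
theorem isSweepOut_startSet (h1 : S.H1) (h2 : S.H2) (v : Fin m) :
    IsSweepOut (vershik hS) (S.startSet v) := by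
  intro y
  have hsusp := isSuspension_tail (hS := hS) h2 1
  obtain ⟨e, hes, het⟩ := exists_edge h1 v (term (vershik hS (tail h2 1 y)) 0)
  have hlt : edgeOffset 0 e < hgt S 1 (term (vershik hS (tail h2 1 y)) 0) := by
    rw [← het]
    exact (Nat.lt_add_of_pos_right (hgt_pos 0 _)).trans_le (edgeOffset_add_hgt_le 0 e)
  obtain ⟨q, hq⟩ := Nat.exists_eq_add_of_lt (Nat.lt_add_right (edgeOffset 0 e) (hsusp.lt y))
  obtain ⟨htail, hrank⟩ := hsusp.iterate_eq (z := y) (n := 1) (q := q + 1) hlt (by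
    rw [birkhoffSum_one, hq, add_assoc])
  have hterm : term ((vershik hS)^[q + 1] y) 1 = S.t e := by
    rw [het, ← Function.iterate_one (vershik hS), ← htail, term_tail, Function.iterate_one]
  have hedge := (rank_succ_eq_iff (hgt_pos 0 _)).1 ⟨hterm, by rw [hrank, zero_add]⟩
  exact ⟨q + 1, q.succ_pos, by rw [startSet, Set.mem_ofPred_eq, term_eq_source, hedge.1, hes]⟩

/-- The first `p` stationary edges of the two paths are the same. -/
def Agree (p : ℕ) (y z : S.X) : Prop := ∀ i < p, edge y i = edge z i

namespace Agree

theorem mono {q : ℕ} (h : Agree q y z) (hpq : p ≤ q) : Agree p y z := fun i hi => h i (by omega)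

theorem term_eq (h : Agree p y z) {i : ℕ} (hi : i < p) : term y i = term z i := by
  rw [term_eq_source, term_eq_source, h i hi]

theorem mem_startSet_iff (h : Agree p y z) (hp : 1 ≤ p) :
    y ∈ S.startSet v ↔ z ∈ S.startSet v := by
  rw [startSet, Set.mem_ofPred_eq, Set.mem_ofPred_eq, h.term_eq hp]

theorem vershik_of_not_isMax (h2 : S.H2) (h : Agree p y z) (hmax : ∃ i < p, ¬ IsMax (edge y i)) :
    Agree p (vershik hS y) (vershik hS z) := by
  have hmax' : ∃ i < p, ¬ IsMax (edge z i) := by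
    obtain ⟨i, hi, hyi⟩ := hmax
    exact ⟨i, hi, h i hi ▸ hyi⟩
  obtain ⟨hrank, hafter⟩ := (isEdgeSucc_vershik hS h2 y).rank_eq hmax
  obtain ⟨hrank', hafter'⟩ := (isEdgeSucc_vershik hS h2 z).rank_eq hmax'
  refine edge_eq_of_rank_eq ?_ (by rw [hrank, hrank', rank_congr h])
  rw [term_eq_source, term_eq_source, hafter p le_rfl, hafter' p le_rfl]
  obtain ⟨i, hi, -⟩ := hmax
  obtain ⟨q, rfl⟩ := Nat.exists_eq_add_of_lt (Nat.zero_lt_of_lt hi)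
  rw [← target_edge, ← target_edge, h _ (by omega)]

-- All the new edges are minimal, and by `H3` the last one starts at a known vertex.
theorem vershik_of_isMax [NeZero m] (h2 : S.H2) (h3 : S.H3) (h : Agree (p + 1) y z)
    (hmax : ∀ i < p + 1, IsMax (edge y i)) : Agree p (vershik hS y) (vershik hS z) := by
  have hy := (isEdgeSucc_vershik hS h2 y).isMin hmax
  have hz := (isEdgeSucc_vershik hS h2 z).isMin fun i hi => h i hi ▸ hmax i hi
  refine edge_eq_of_rank_eq ?_ ?_
  · rw [term_eq_source, term_eq_source, h3 _ (hy p (by omega)), h3 _ (hz p (by omega))]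
  · rw [rank_eq_zero_iff.2 fun i hi => hy i (by omega),
      rank_eq_zero_iff.2 fun i hi => hz i (by omega)]

end Agree

/-- The relation between two orbits that start with the same `p + 1` edges, which persists until
they visit `startSet v`. The edge of index `p` may be lost, but only when `edge y 0` becomes
minimal; from then on the first edge runs upwards and reaches one starting at `v` before becoming
maximal. -/
def AgreeUntilVisit (v : Fin m) (p : ℕ) (y z : S.X) : Prop :=
  Agree (p + 1) y z ∨ Agree p y z ∧ ∀ e ≤ edge y 0, S.s e ≠ v

namespace AgreeUntilVisit

variable [NeZero m]

theorem agree_vershik (h1 : S.H1) (h2 : S.H2) (h3 : S.H3) (hp : 1 ≤ p)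
    (h : AgreeUntilVisit v p y z) :
    Agree p (vershik hS y) (vershik hS z) ∧
      (vershik hS y ∉ S.startSet v → AgreeUntilVisit v p (vershik hS y) (vershik hS z)) := by
  have hsucc := isEdgeSucc_vershik hS h2 y
  have hsource (hV : vershik hS y ∉ S.startSet v) :
      S.s (edge (vershik hS y) 0) ≠ v := by
    rwa [← term_eq_source]
  rcases h with h | ⟨h, hne⟩
  · by_cases hmax : ∃ i < p + 1, ¬ IsMax (edge y i)
    · have := h.vershik_of_not_isMax (hS := hS) h2 hmax
      exact ⟨this.mono (by omega), fun _ => Or.inl this⟩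
    · push Not at hmax
      have hagree := h.vershik_of_isMax (hS := hS) h2 h3 hmax
      refine ⟨hagree, fun hV => Or.inr ⟨hagree, fun e he => ?_⟩⟩
      rw [(hsucc.isMin hmax 0 p.succ_pos).eq_of_le he]
      exact hsource hV
  · have hmax : ¬ IsMax (edge y 0) := fun hmax =>
      (exists_edge h1 v (S.t (edge y 0))).elim fun e he => hne e (le_of_isMax hmax he.2) he.1
    have hagree := h.vershik_of_not_isMax (hS := hS) h2 ⟨0, by omega, hmax⟩
    refine ⟨hagree, fun hV => Or.inr ⟨hagree, fun e he => ?_⟩⟩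
    obtain ⟨k, hk, -, hcov, -⟩ := hsucc.exists_covBy (p := 1) ⟨0, one_pos, hmax⟩
    obtain rfl := Nat.lt_one_iff.1 hk
    rcases he.eq_or_lt with rfl | hlt
    · exact hsource hV
    · exact hne e (le_of_lt_of_covBy hcov hlt)

theorem iterate (h1 : S.H1) (h2 : S.H2) (h3 : S.H3) (hp : 1 ≤ p) (h : AgreeUntilVisit v p y z)
    {n : ℕ} (hn : n + 1 ≤ entranceTime (vershik hS) (S.startSet v) 1 y) :
    Agree p ((vershik hS)^[n + 1] y)
      ((vershik hS)^[n + 1] z) := by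
  induction n generalizing y z with
  | zero => exact (h.agree_vershik (hS := hS) h1 h2 h3 hp).1
  | succ n ih =>
    obtain ⟨-, hnext⟩ := h.agree_vershik (hS := hS) h1 h2 h3 hp
    have hV : vershik hS y ∉ S.startSet v := fun hV => by
      rw [entranceTime_one_of_mem hV] at hn
      omega
    rw [entranceTime_one_of_notMem (isSweepOut_startSet h1 h2 v) hV] at hn
    exact ih (hnext hV) (by omega)

end AgreeUntilVisit

namespace Agree

variable [NeZero m]

theorem iterate (h1 : S.H1) (h2 : S.H2) (h3 : S.H3) (hp : 1 ≤ p) (h : Agree (p + 1) y z) {n : ℕ}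
    (hn : n ≤ entranceTime (vershik hS) (S.startSet v) 1 y) :
    Agree p ((vershik hS)^[n] y) ((vershik hS)^[n] z) := by
  cases n with
  | zero => exact h.mono p.le_succ
  | succ n => exact AgreeUntilVisit.iterate h1 h2 h3 hp (Or.inl h) hn

theorem entranceTime_one (h1 : S.H1) (h2 : S.H2) (h3 : S.H3) (hp : 1 ≤ p) (h : Agree (p + 1) y z) :
    entranceTime (vershik hS) (S.startSet v) 1 y =
      entranceTime (vershik hS) (S.startSet v) 1 z := by
  have hrec := isSweepOut_startSet (hS := hS) h1 h2 v
  have hvisit {n : ℕ} (hn : n ≤ entranceTime (vershik hS) (S.startSet v) 1 y) :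
      (vershik hS)^[n] y ∈ S.startSet v ↔ (vershik hS)^[n] z ∈ S.startSet v :=
    (h.iterate h1 h2 h3 hp hn).mem_startSet_iff hp
  refine (entranceTime_succ_eq (k := 0) (entranceTime_one_pos hrec y)
    ((hvisit le_rfl).1 (entrancePoint_succ_mem hrec 0 y)) fun q hq hzq => ?_).symm
  by_contra! hlt
  exact hlt.not_ge (entranceTime_succ_le hq ((hvisit hlt.le).2 hzq))

theorem agree_entrancePoint_one (h1 : S.H1) (h2 : S.H2) (h3 : S.H3) (hp : 1 ≤ p)
    (h : Agree (p + 1) y z) :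
    Agree p (entrancePoint (vershik hS) (S.startSet v) 1 y)
      (entrancePoint (vershik hS) (S.startSet v) 1 z) := by
  rw [entrancePoint, entrancePoint, ← h.entranceTime_one h1 h2 h3 hp]
  exact h.iterate h1 h2 h3 hp le_rfl

theorem agree_entrancePoint (h1 : S.H1) (h2 : S.H2) (h3 : S.H3) (hp : 1 ≤ p) (k : ℕ)
    (h : Agree (p + k) y z) :
    Agree p (entrancePoint (vershik hS) (S.startSet v) k y)
      (entrancePoint (vershik hS) (S.startSet v) k z) := by
  induction k generalizing p with
  | zero => exact h
  | succ k ih =>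
    have hprev := ih (p := p + 1) (by omega) (h.mono (by omega))
    have hrec := isSweepOut_startSet (hS := hS) h1 h2 v
    rw [entrancePoint_succ hrec k y, entrancePoint_succ hrec k z]
    exact hprev.agree_entrancePoint_one h1 h2 h3 hp

end Agree

/-- The edges `z_{p+2} z_{p+3}` behind the vertex of `z` in `V_{p+1}`. -/
def edgePair (z : S.X) (p : ℕ) : S.E × S.E := (edge z p, edge z (p + 1))

variable (hS) in
/-- The vectors `c(ef)`, read off on the paths that start at `v ∈ V_1`. -/
noncomputable def passageCount (v : Fin m) (e f : S.E) (i : Fin m) : ℕ :=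
  Function.extend (fun y : S.startSet v => edgePair y.1 0)
    (fun y => {n | n < entranceTime (vershik hS) (S.startSet v) 1 y.1 ∧
      (vershik hS)^[n] y.1 ∈ S.startSet i}.ncard) 0 (e, f)

variable (hS) in
/-- The paths `e₁^{(k)} e₂^{(k)}`, read off on the paths that start at `v ∈ V_1`. -/
noncomputable def returnPath (v : Fin m) (k : ℕ) : (Fin (k + 1) → S.E) → S.E × S.E :=
  Function.extend (fun (y : S.startSet v) (a : Fin (k + 1)) => edge y.1 a)
    (fun y => edgePair (entrancePoint (vershik hS) (S.startSet v) (k - 1) y.1) 0)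
    fun e => (e 0, e 0)

variable (hS) in
/-- The return time to a cylinder `I` that ends at `v ∈ V_{p+1}`, at the points of `I a` for a pair
of edges `a`. -/
noncomputable def returnTime (v : Fin m) (p : ℕ) (a : S.E × S.E) : ℕ :=
  ∑ i, passageCount hS v a.1 a.2 i * hgt S p i

variable {x : S.X}

theorem tail_mem_startSet_of_mem_cyl (h2 : S.H2) (hx : term x p = v) (hz : z ∈ cyl x (p + 1)) :
    tail h2 p z ∈ S.startSet v := by
  rw [cyl_eq h2, hx] at hz
  exact hz.1

theorem rank_lt_of_mem_startSet (x : S.X) (p : ℕ) :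
    ∀ y ∈ S.startSet (term x p), rank p x < hgt S p (term y 0) := by
  rintro y hy
  rw [show term y 0 = term x p from hy]
  exact rank_lt p x

theorem isSweepOut_cyl (h1 : S.H1) (h2 : S.H2) (x : S.X) (p : ℕ) :
    IsSweepOut (vershik hS) (cyl x (p + 1)) := by
  rw [cyl_eq h2]
  exact (isSuspension_tail h2 p).isSweepOut_floor (isSweepOut_startSet h1 h2 _)
    (rank_lt_of_mem_startSet x p)

theorem entrancePoint_cyl (h1 : S.H1) (h2 : S.H2) (hz : z ∈ cyl x (p + 1)) (k : ℕ) :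
    entrancePoint (vershik hS) (cyl x (p + 1)) k z ∈ cyl x (p + 1) ∧
      tail h2 p (entrancePoint (vershik hS) (cyl x (p + 1)) k z) =
        entrancePoint (vershik hS) (S.startSet (term x p)) k (tail h2 p z) := by
  rw [cyl_eq h2] at hz ⊢
  exact (isSuspension_tail h2 p).entrancePoint_floor (isSweepOut_startSet h1 h2 _)
    (rank_lt_of_mem_startSet x p) hz k

variable [NeZero m]

theorem passageCount_eq (h1 : S.H1) (h2 : S.H2) (h3 : S.H3) (hy : y ∈ S.startSet v) (i : Fin m) :
    passageCount hS v (edge y 0) (edge y 1) i =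
      {n | n < entranceTime (vershik hS) (S.startSet v) 1 y ∧
        (vershik hS)^[n] y ∈ S.startSet i}.ncard := by
  refine Function.FactorsThrough.extend_apply (fun y z hyz => ?_) _ (⟨y, hy⟩ : S.startSet v)
  have hagree : Agree (1 + 1) y.1 z.1 := fun i hi => by
    interval_cases i
    · exact congrArg Prod.fst hyz
    · exact congrArg Prod.snd hyz
  congr 1
  ext n
  rw [Set.mem_ofPred_eq, Set.mem_ofPred_eq, ← hagree.entranceTime_one h1 h2 h3 le_rfl]
  exact and_congr_right fun hn =>
    (hagree.iterate h1 h2 h3 le_rfl hn.le).mem_startSet_iff le_rfl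

theorem returnPath_eq (h1 : S.H1) (h2 : S.H2) (h3 : S.H3) (hy : y ∈ S.startSet v) {k : ℕ}
    (hk : 1 ≤ k) : returnPath hS v k (fun a => edge y a) =
      edgePair (entrancePoint (vershik hS) (S.startSet v) (k - 1) y) 0 := by
  refine Function.FactorsThrough.extend_apply (fun y z hyz => ?_) _ (⟨y, hy⟩ : S.startSet v)
  have hagree : Agree (2 + (k - 1)) y.1 z.1 := fun i hi => congrFun hyz ⟨i, by omega⟩
  have hpoint := hagree.agree_entrancePoint (hS := hS) (v := v) h1 h2 h3 one_le_two (k - 1)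
  exact Prod.ext (hpoint 0 two_pos) (hpoint 1 one_lt_two)

theorem isPassageCount_passageCount (h1 : S.H1) (h2 : S.H2) (h3 : S.H3) (v : Fin m) :
    S.IsPassageCount hS v (passageCount hS v) := by
  rintro p x rfl z hz i
  have hrec := isSweepOut_startSet (hS := hS) h1 h2 (term x p)
  have hy := tail_mem_startSet_of_mem_cyl h2 rfl hz
  rw [cyl_eq h2] at hz ⊢
  rw [minCyl_eq h2, (isSuspension_tail h2 p).ncard_visits hrec (rank_lt_of_mem_startSet x p) hz]
  · exact passageCount_eq h1 h2 h3 hy i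
  · have hback := entrancePoint_succ_mem hrec 0 (tail h2 p z)
    simp only [startSet, Set.mem_ofPred_eq] at hy hback ⊢
    rw [hy, hback]

theorem returnPath_eq_edgePair (h1 : S.H1) (h2 : S.H2) (h3 : S.H3) (hx : term x p = v)
    (hz : z ∈ cyl x (p + 1)) {k : ℕ} (hk : 1 ≤ k) :
    returnPath hS v k (fun a => edge z (p + a)) =
      edgePair (entrancePoint (vershik hS) (cyl x (p + 1)) (k - 1) z) p := by
  refine (returnPath_eq h1 h2 h3 (tail_mem_startSet_of_mem_cyl h2 hx hz) hk).trans ?_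
  rw [← hx, ← (entrancePoint_cyl h1 h2 hz (k - 1)).2]
  rfl

theorem isReturnPath_returnPath (h1 : S.H1) (h2 : S.H2) (h3 : S.H3) (v : Fin m) :
    S.IsReturnPath hS v (returnPath hS v) := by
  rintro p x hx z hz k hk w rfl
  exact ⟨(entrancePoint_cyl h1 h2 hz (k - 1)).1, returnPath_eq_edgePair h1 h2 h3 hx hz hk⟩

theorem entranceTime_cyl (h1 : S.H1) (h2 : S.H2) (h3 : S.H3) (hx : term x p = v)
    (hz : z ∈ cyl x (p + 1)) :
    entranceTime (vershik hS) (cyl x (p + 1)) 1 z = returnTime hS v p (edgePair z p) := by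
  classical
  have hy := tail_mem_startSet_of_mem_cyl h2 hx hz
  subst hx
  rw [cyl_eq h2] at hz ⊢
  rw [(isSuspension_tail h2 p).entranceTime_floor (isSweepOut_startSet h1 h2 _)
      (rank_lt_of_mem_startSet x p) hz.2, birkhoffSum, returnTime,
    ← Finset.sum_fiberwise (Finset.range _) fun n => term ((vershik hS)^[n] (tail h2 p z)) 0]
  refine Finset.sum_congr rfl fun i _ => ?_
  rw [Finset.sum_congr rfl (g := fun _ => hgt S p i) fun n hn => by rw [(Finset.mem_filter.1 hn).2],
    Finset.sum_const, smul_eq_mul]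
  refine congrArg (· * hgt S p i) (Eq.trans ?_ (passageCount_eq h1 h2 h3 hy i).symm)
  rw [← Set.ncard_coe_finset]
  congr 1
  ext n
  simp [startSet, Set.mem_ofPred_eq]

theorem entranceTime_cyl_of_pos (h1 : S.H1) (h2 : S.H2) (h3 : S.H3) (hx : term x p = v)
    (hz : z ∈ cyl x (p + 1)) {k : ℕ} (hk : 1 ≤ k) :
    entranceTime (vershik hS) (cyl x (p + 1)) k z =
      entranceTime (vershik hS) (cyl x (p + 1)) (k - 1) z +
        returnTime hS v p (returnPath hS v k fun a => edge z (p + a)) := by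
  rw [returnPath_eq_edgePair h1 h2 h3 hx hz hk,
    ← entranceTime_cyl h1 h2 h3 hx (entrancePoint_cyl h1 h2 hz (k - 1)).1]
  obtain ⟨k, rfl⟩ := Nat.exists_eq_add_of_le' hk
  exact entranceTime_succ (isSweepOut_cyl h1 h2 x p) k z

end Returns

/-! ### The incidence matrix -/

section Incidence

variable {lam : ℝ} {r l : Fin m → ℝ}

open Classical in
theorem M_eq_card (i j : Fin m) :
    S.M i j = (Finset.card {e : S.E | S.s e = i ∧ S.t e = j} : ℝ) := by
  rw [M, Nat.card_eq_fintype_card, Fintype.card_subtype]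

open Classical in
theorem M_mulVec_eq_sum (f : Fin m → ℝ) (i : Fin m) :
    (S.M *ᵥ f) i = ∑ e : S.E with S.s e = i, f (S.t e) := by
  rw [← Finset.sum_fiberwise _ S.t, Matrix.mulVec, dotProduct]
  refine Finset.sum_congr rfl fun j _ => ?_
  rw [Finset.filter_filter, M_eq_card, ← nsmul_eq_mul]
  exact (Finset.sum_eq_card_nsmul fun e he => by rw [(Finset.mem_filter.1 he).2.2]).symm

open Classical in
theorem vecMul_M_eq_sum (f : Fin m → ℝ) (j : Fin m) :
    (f ᵥ* S.M) j = ∑ e : S.E with S.t e = j, f (S.s e) := by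
  rw [← Finset.sum_fiberwise _ S.s, Matrix.vecMul, dotProduct]
  refine Finset.sum_congr rfl fun i _ => ?_
  simp only [Finset.filter_filter, M_eq_card, mul_comm (f i), ← nsmul_eq_mul, and_comm]
  exact (Finset.sum_eq_card_nsmul fun e he => by rw [(Finset.mem_filter.1 he).2.1]).symm

theorem one_le_M (h1 : S.H1) (i j : Fin m) : 1 ≤ S.M i j := by
  have hpos := h1 i j
  rw [M, Nat.cast_pos] at hpos
  rw [M, Nat.one_le_cast]
  exact hpos

theorem card_edge_le (hP : IsPerronTriple S.M lam r l) : (Fintype.card S.E : ℝ) ≤ lam ^ 2 := by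
  classical
  have := hP.nonempty
  have hsum : 0 < ∑ j, r j := Finset.sum_pos (fun j _ => hP.right_pos j) Finset.univ_nonempty
  have hrow (i : Fin m) : ∑ j, r j ≤ lam * r i :=
    calc ∑ j, r j ≤ ∑ j, S.M i j * r j := Finset.sum_le_sum fun j _ =>
          le_mul_of_one_le_left (hP.right_pos j).le (one_le_M hP.pos i j)
      _ = lam * r i := congrFun hP.mulVec_eq i
  refine le_of_mul_le_mul_right ?_ hsum
  calc (Fintype.card S.E : ℝ) * ∑ j, r j
      = ∑ _e : S.E, ∑ j, r j := by rw [Finset.sum_const, nsmul_eq_mul, Finset.card_univ]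
    _ ≤ ∑ e : S.E, lam * r (S.t e) := Finset.sum_le_sum fun e _ => hrow _
    _ = lam * ∑ i, (S.M *ᵥ r) i := by
        simp only [M_mulVec_eq_sum, Finset.sum_fiberwise, Finset.mul_sum]
    _ = lam ^ 2 * ∑ j, r j := by
        simp only [hP.mulVec_eq, Pi.smul_apply, smul_eq_mul, ← Finset.mul_sum, pow_two, mul_assoc]

theorem one_lt_eigenvalue [Infinite S.X] (h2 : S.H2) (hP : IsPerronTriple S.M lam r l) :
    1 < lam := by
  have hE : Nontrivial S.E := by
    by_contra hE
    rw [not_nontrivial_iff_subsingleton] at hE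
    have : Subsingleton S.X := ⟨fun z w => path_ext h2 fun k => Subsingleton.elim _ _⟩
    exact not_finite S.X
  have hcard : (1 : ℝ) < Fintype.card S.E := Nat.one_lt_cast.2 Fintype.one_lt_card
  exact (one_lt_sq_iff₀ hP.eigenvalue_pos.le).1 (hcard.trans_le (card_edge_le hP))

theorem tendsto_hgt (hP : IsPerronTriple S.M lam r l) (hr_sum : ∑ i, r i = 1) (i : Fin m) :
    Tendsto (fun p => (hgt S p i : ℝ) / lam ^ p) atTop (𝓝 (l i)) := by
  classical
  have hsucc (p : ℕ) : (fun j => (hgt S (p + 1) j : ℝ)) = (fun j => (hgt S p j : ℝ)) ᵥ* S.M := by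
    funext j
    rw [vecMul_M_eq_sum, hgt, Nat.cast_sum]
  simpa [hgt, dotProduct, hr_sum] using
    hP.tendsto_of_eq_vecMul (f := fun p j => (hgt S p j : ℝ)) hsucc i

end Incidence

/-! ### The invariant measure -/

section Measure

variable {hS : S.toDiagram.ProperlyOrdered} {μ : Measure S.X} {lam : ℝ} {r l : Fin m → ℝ}

theorem measurableSet_cyl (x : S.X) (n : ℕ) : MeasurableSet (cyl x n) :=
  MeasurableSpace.measurableSet_generateFrom ⟨x, n, rfl⟩

theorem measurableSet_floor (h2 : S.H2) (p : ℕ) (i : Fin m) (a : ℕ) :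
    MeasurableSet (suspensionFloor (tail h2 p) (rank p) (S.startSet i) a) := by
  rcases Set.eq_empty_or_nonempty (suspensionFloor (tail h2 p) (rank p) (S.startSet i) a)
    with h | ⟨x, hx, rfl⟩
  · rw [h]
    exact MeasurableSet.empty
  · obtain rfl := (tail_mem_startSet h2).1 hx
    rw [← cyl_eq]
    exact measurableSet_cyl x _

theorem measureReal_floor (h2 : S.H2) (hμ : MeasurePreserving (vershik hS) μ μ) {p a : ℕ}
    {i : Fin m} (ha : a < hgt S p i) :
    μ.real (suspensionFloor (tail h2 p) (rank p) (S.startSet i) a) =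
      μ.real (suspensionFloor (tail h2 p) (rank p) (S.startSet i) 0) :=
  (isSuspension_tail h2 p).measureReal_floor hμ (measurableSet_floor h2 p i) fun y hy => by
    rwa [show term y 0 = i from hy]

theorem measureReal_base_eq_mulVec [IsFiniteMeasure μ] (h2 : S.H2)
    (hμ : MeasurePreserving (vershik hS) μ μ) (p : ℕ) :
    (fun i => μ.real (suspensionFloor (tail h2 p) (rank p) (S.startSet i) 0)) =
      S.M *ᵥ fun j =>
        μ.real (suspensionFloor (tail h2 (p + 1)) (rank (p + 1)) (S.startSet j) 0) := by
  classical
  funext i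
  have hmem {e : S.E} {z : S.X} :
      z ∈ suspensionFloor (tail h2 (p + 1)) (rank (p + 1)) (S.startSet (S.t e)) (edgeOffset p e) ↔
        edge z p = e ∧ rank p z = 0 := by
    rw [← rank_succ_eq_iff (hgt_pos p _), zero_add]
    exact and_congr_left' (tail_mem_startSet h2)
  have hlt (e : S.E) : edgeOffset p e < hgt S (p + 1) (S.t e) :=
    (Nat.lt_add_of_pos_right (hgt_pos p _)).trans_le (edgeOffset_add_hgt_le p e)
  rw [M_mulVec_eq_sum, Finset.sum_congr rfl fun e _ => (measureReal_floor h2 hμ (hlt e)).symm,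
    ← measureReal_biUnion_finset]
  · congr 1
    ext z
    simp only [Set.mem_iUnion, Finset.mem_filter, Finset.mem_univ, true_and, exists_prop, hmem]
    refine (and_congr_left' (tail_mem_startSet h2)).trans ?_
    rw [term_eq_source]
    exact ⟨fun ⟨hs, h0⟩ => ⟨edge z p, hs, rfl, h0⟩, by rintro ⟨e, hs, rfl, h0⟩; exact ⟨hs, h0⟩⟩
  · exact fun e _ f _ hef => Set.disjoint_left.2 fun z he hf =>
      hef ((hmem.1 he).1.symm.trans (hmem.1 hf).1)
  · exact fun e _ => measurableSet_floor h2 _ _ _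

theorem sum_measureReal_startSet [IsProbabilityMeasure μ] (h2 : S.H2) :
    ∑ i, μ.real (suspensionFloor (tail h2 0) (rank 0) (S.startSet i) 0) = 1 := by
  have hmem {i : Fin m} {z : S.X} :
      z ∈ suspensionFloor (tail h2 0) (rank 0) (S.startSet i) 0 ↔ term z 0 = i :=
    ⟨fun h => (tail_mem_startSet h2).1 h.1, fun h => ⟨(tail_mem_startSet h2).2 h, rfl⟩⟩
  rw [← measureReal_biUnion_finset, ← probReal_univ (μ := μ)]
  · congr 1
    ext z
    simp [hmem]
  · exact fun i _ j _ hij => Set.disjoint_left.2 fun z hi hj =>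
      hij ((hmem.1 hi).symm.trans (hmem.1 hj))
  · exact fun i _ => measurableSet_floor h2 _ _ _

theorem measureReal_cyl [IsProbabilityMeasure μ] (h2 : S.H2)
    (hμ : MeasurePreserving (vershik hS) μ μ) (hP : IsPerronTriple S.M lam r l)
    (hr_sum : ∑ i, r i = 1) (x : S.X) (p : ℕ) :
    μ.real (cyl x (p + 1)) = r (term x p) / lam ^ p := by
  have hbase := hP.eq_of_eq_mulVec_succ (measureReal_base_eq_mulVec h2 hμ)
    fun _ _ => measureReal_nonneg
  have hmass := (Finset.sum_congr rfl fun i _ => hbase 0 i).symm.trans (sum_measureReal_startSet h2)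
  simp only [pow_zero, div_one, ← Finset.mul_sum, hr_sum, mul_one] at hmass
  rw [cyl_eq h2, measureReal_floor h2 hμ (rank_lt p x), hbase, hmass, one_mul]

end Measure

/-! ### Extensions of a cylinder -/

section Extensions

variable {hS : S.toDiagram.ProperlyOrdered} {v : Fin m} {p k : ℕ} {x z : S.X}
  {e : Fin (k + 1) → S.E}

theorem mem_pathsFrom :
    e ∈ S.pathsFrom v k ↔ S.s (e 0) = v ∧ ∀ a : Fin k, S.t (e a.castSucc) = S.s (e a.succ) := by
  simp [pathsFrom]

theorem mem_pairsFrom {a : S.E × S.E} :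
    a ∈ S.pairsFrom v ↔ S.s a.1 = v ∧ S.t a.1 = S.s a.2 := by
  simp [pairsFrom]

theorem sum_pathsFrom_one (f : S.E × S.E → ℝ) :
    ∑ e ∈ S.pathsFrom v 1, f (e 0, e 1) = ∑ a ∈ S.pairsFrom v, f a := by
  refine Finset.sum_equiv (finTwoArrowEquiv S.E) (fun e => ?_) fun _ _ => rfl
  rw [mem_pathsFrom, mem_pairsFrom, Fin.forall_fin_one]
  rfl

theorem exists_edge_eq (h2 : S.H2) (f : ℕ → S.E) (n : ℕ)
    (hf : ∀ k < n, S.t (f k) = S.s (f (k + 1))) : ∃ z : S.X, ∀ k ≤ n, edge z k = f k := by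
  choose next hnext using fun e : S.E => S.s_surj (S.t e)
  refine ⟨ofEdges h2 (fun k => next^[k - n] (f (min k n))) fun k => ?_, fun k hk => ?_⟩
  · rcases lt_or_ge k n with hk | hk
    · rw [Nat.sub_eq_zero_of_le hk.le, Nat.sub_eq_zero_of_le hk, min_eq_left hk.le, min_eq_left hk]
      exact hf k hk
    · rw [min_eq_right hk, min_eq_right (by omega), Nat.succ_sub hk, Function.iterate_succ_apply',
        hnext]
  · change next^[k - n] (f (min k n)) = f k
    rw [Nat.sub_eq_zero_of_le hk, min_eq_left hk, Function.iterate_zero_apply]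

/-- The cylinder `[I e₁ … e_{k+1}]`, where `I = [x₁, …, x_{p+1}]`. -/
def cylExt (x : S.X) (p : ℕ) (e : Fin (k + 1) → S.E) : Set S.X :=
  {z | z ∈ cyl x (p + 1) ∧ ∀ a : Fin (k + 1), edge z (p + a) = e a}

theorem cylExt_nonempty (h2 : S.H2) (hx : term x p = v) (he : e ∈ S.pathsFrom v k) :
    (cylExt x p e).Nonempty := by
  obtain ⟨hsource, hchain⟩ := mem_pathsFrom.1 he
  obtain ⟨z, hz⟩ := exists_edge_eq h2
    (fun n => if n < p then edge x n else e (Fin.ofNat (k + 1) (n - p))) (p + k) fun n hn => by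
      rcases lt_trichotomy (n + 1) p with h | rfl | h
      · rw [if_pos (by omega), if_pos h, target_edge]
      · rw [if_pos n.lt_succ_self, if_neg (lt_irrefl _), Nat.sub_self]
        exact hx.trans hsource.symm
      · obtain ⟨a, rfl⟩ := Nat.exists_eq_add_of_le (Nat.lt_succ_iff.1 h)
        rw [if_neg (by omega), if_neg (by omega), add_assoc, Nat.add_sub_cancel_left,
          Nat.add_sub_cancel_left]
        convert hchain ⟨a, by omega⟩ using 3 <;> ext <;> simp <;> omega
  have hedge (a : Fin (k + 1)) : edge z (p + a) = e a := by
    rw [hz _ (by omega), if_neg (by omega), Nat.add_sub_cancel_left, Fin.ofNat_eq_cast,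
      Fin.cast_val_eq_self]
  refine ⟨z, ?_, hedge⟩
  rw [cyl_eq h2, hx]
  refine ⟨(tail_mem_startSet h2).2 ?_, rank_congr fun i hi => ?_⟩
  · rw [term_eq_source, ← hsource]
    exact congrArg S.s (hedge 0)
  · rw [hz i (by omega), if_pos hi]

theorem cylExt_eq_cyl (hz : z ∈ cylExt x p e) : cylExt x p e = cyl z (p + k + 1 + 1) := by
  obtain ⟨hzx, hze⟩ := hz
  ext w
  constructor
  · rintro ⟨hwx, hwe⟩ i hi
    rcases lt_or_ge i (p + 1) with hip | hip
    · exact (hwx i hip).trans (hzx i hip).symm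
    · obtain ⟨a, rfl⟩ := Nat.exists_eq_add_of_le hip
      rw [add_right_comm]
      exact (hwe ⟨a, by omega⟩).trans (hze ⟨a, by omega⟩).symm
  · exact fun hw => ⟨fun i hi => (hw i (by omega)).trans (hzx i hi),
      fun a => (hw (p + a + 1) (by omega)).trans (hze a)⟩

theorem measurableSet_cylExt : MeasurableSet (cylExt x p e) := by
  rcases Set.eq_empty_or_nonempty (cylExt x p e) with h | ⟨z, hz⟩
  · rw [h]
    exact MeasurableSet.empty
  · rw [cylExt_eq_cyl hz]
    exact measurableSet_cyl z _

theorem measureReal_cylExt {μ : Measure S.X} [IsProbabilityMeasure μ] {lam : ℝ} {r l : Fin m → ℝ}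
    (h2 : S.H2) (hμ : MeasurePreserving (vershik hS) μ μ) (hP : IsPerronTriple S.M lam r l)
    (hr_sum : ∑ i, r i = 1) (hx : term x p = v) (he : e ∈ S.pathsFrom v k) :
    μ.real (cylExt x p e) = r (S.t (e (Fin.last k))) / lam ^ (p + k + 1) := by
  obtain ⟨z, hz⟩ := cylExt_nonempty h2 hx he
  rw [cylExt_eq_cyl hz, measureReal_cyl h2 hμ hP hr_sum, ← hz.2 (Fin.last k)]
  rfl

theorem biUnion_cylExt (hx : term x p = v) (k : ℕ) :
    ⋃ e ∈ S.pathsFrom v k, cylExt x p e = cyl x (p + 1) := by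
  ext z
  simp only [Set.mem_iUnion, exists_prop]
  constructor
  · rintro ⟨e, -, hz, -⟩
    exact hz
  · intro hz
    have hterm : term z p = term x p := congrArg (S.toDiagram.t p) (hz p p.lt_succ_self)
    refine ⟨fun a => edge z (p + a), mem_pathsFrom.2 ⟨?_, fun a => target_edge z (p + a)⟩, hz,
      fun a => rfl⟩
    rw [← hx, ← hterm, term_eq_source]
    rfl

variable [NeZero m]

theorem isReturnPartition_cylExt (h1 : S.H1) (h2 : S.H2) (h3 : S.H3) (hx : term x p = v) (k : ℕ) :
    IsReturnPartition (vershik hS) (cyl x (p + 1)) (S.pathsFrom v (k + 1)) (cylExt x p)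
      (fun e => returnTime hS v p (e 0, e 1)) where
  measurableSet _ _ := measurableSet_cylExt
  pairwiseDisjoint e _ f _ hef := Set.disjoint_left.2 fun _ he hf =>
    hef (funext fun a => (he.2 a).symm.trans (hf.2 a))
  biUnion_eq := biUnion_cylExt hx (k + 1)
  entranceTime_eq e _ z hz := by
    rw [entranceTime_cyl h1 h2 h3 hx hz.1, ← hz.2 0, ← hz.2 1]
    rfl

theorem returnPath_mem_pairsFrom (h1 : S.H1) (h2 : S.H2) (h3 : S.H3) (hx : term x p = v)
    (hk : 1 ≤ k) (he : e ∈ S.pathsFrom v k) : returnPath hS v k e ∈ S.pairsFrom v := by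
  obtain ⟨z, hz, hze⟩ := cylExt_nonempty h2 hx he
  rw [← funext hze, returnPath_eq_edgePair h1 h2 h3 hx hz hk]
  have hmem := (entrancePoint_cyl (hS := hS) h1 h2 hz (k - 1)).1
  refine mem_pairsFrom.2 ⟨?_, target_edge _ p⟩
  exact (term_eq_source _ p).symm.trans
    ((congrArg (S.toDiagram.t p) (hmem p p.lt_succ_self)).trans hx)

end Extensions

/-! ### The thresholds -/

section Thresholds

variable {v : Fin m} {c : S.E → S.E → Fin m → ℕ} {l r : Fin m → ℝ} {i j : ℕ} {u : ℝ}
  {a : S.E × S.E}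

theorem mem_Sset_succ : a ∈ Sset v c l (i + 1) ↔ ∃ h : i < (cvals v c l).card,
    a ∈ S.pairsFrom v ∧ cbar c l a = (cvals v c l).orderEmbOfFin rfl ⟨i, h⟩ := by
  rw [Sset]
  split_ifs with h <;> simp [h]

theorem mem_pairsFrom_of_mem_Sset (ha : a ∈ Sset v c l i) : a ∈ S.pairsFrom v := by
  cases i with
  | zero => exact absurd ha (Finset.notMem_empty a)
  | succ i => exact (mem_Sset_succ.1 ha).2.1

theorem exists_mem_Sset (ha : a ∈ S.pairsFrom v) :
    ∃ i, 1 ≤ i ∧ i ≤ (cvals v c l).card ∧ a ∈ Sset v c l i := by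
  have hmem : cbar c l a ∈ Set.range ((cvals v c l).orderEmbOfFin rfl) := by
    rw [Finset.range_orderEmbOfFin]
    exact Finset.mem_image_of_mem _ ha
  obtain ⟨⟨i, h⟩, hi⟩ := hmem
  exact ⟨i + 1, by omega, h, mem_Sset_succ.2 ⟨h, ha, hi.symm⟩⟩

theorem d_eq_of_mem_Sset (ha : a ∈ Sset v c l i) :
    d v c l r i = ((cbar c l a * r v : ℝ) : EReal) := by
  cases i with
  | zero => exact absurd ha (Finset.notMem_empty a)
  | succ i =>
    obtain ⟨h, -, hc⟩ := mem_Sset_succ.1 ha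
    rw [d, dif_pos h, hc]

theorem d_le_d (hr : 0 ≤ r v) (hi : 1 ≤ i) (hij : i ≤ j) : d v c l r i ≤ d v c l r j := by
  obtain ⟨i, rfl⟩ := Nat.exists_eq_add_of_le' hi
  obtain ⟨j, rfl⟩ := Nat.exists_eq_add_of_le' (hi.trans hij)
  by_cases hj : j < (cvals v c l).card
  · rw [d, d, dif_pos hj, dif_pos (by omega), EReal.coe_le_coe_iff]
    exact mul_le_mul_of_nonneg_right
      ((Finset.orderEmbOfFin _ rfl).monotone (Fin.mk_le_mk.2 (by omega))) hr
  · rw [d.eq_2 v c l r j, dif_neg hj]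
    exact le_top

theorem d_nonneg (hr : 0 ≤ r v) (hl : ∀ i, 0 ≤ l i) (j : ℕ) : 0 ≤ d v c l r j := by
  cases j with
  | zero => exact le_rfl
  | succ j =>
    rw [d]
    split_ifs with h
    · obtain ⟨a, -, ha⟩ := Finset.mem_image.1 (Finset.orderEmbOfFin_mem (cvals v c l) rfl ⟨j, h⟩)
      rw [← ha]
      exact EReal.coe_nonneg.2
        (mul_nonneg (Finset.sum_nonneg fun i _ => mul_nonneg (Nat.cast_nonneg _) (hl i)) hr)
    · exact le_top

theorem le_iff_of_mem_Sset (hr : 0 ≤ r v) (hj : d v c l r j ≤ u) (hu : u < d v c l r (j + 1))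
    (hi : 1 ≤ i) (ha : a ∈ Sset v c l i) : i ≤ j ↔ cbar c l a * r v ≤ u := by
  rw [← EReal.coe_le_coe_iff, ← d_eq_of_mem_Sset ha]
  refine ⟨fun hij => (d_le_d hr hi hij).trans hj, fun hle => ?_⟩
  by_contra! hij
  exact (hu.trans_le ((d_le_d hr j.succ_pos hij).trans hle)).false

theorem cbar_mul_ne (hr : 0 ≤ r v) (hj : d v c l r j ≤ u) (hu : u < d v c l r (j + 1))
    (hne : 1 ≤ j → (u : EReal) ≠ d v c l r j) (ha : a ∈ S.pairsFrom v) :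
    cbar c l a * r v ≠ u := by
  obtain ⟨i, hi, -, hai⟩ := exists_mem_Sset (c := c) (l := l) ha
  rintro rfl
  have hij := (le_iff_of_mem_Sset hr hj hu hi hai).2 le_rfl
  refine hne (hi.trans hij) (le_antisymm ?_ hj)
  rw [← d_eq_of_mem_Sset hai]
  exact d_le_d hr hi hij

theorem mem_biUnion_Sset_iff [DecidableEq (S.E × S.E)] (hr : 0 ≤ r v) (hj : d v c l r j ≤ u)
    (hu : u < d v c l r (j + 1)) :
    a ∈ (Finset.Icc 1 j).biUnion (Sset v c l) ↔ a ∈ S.pairsFrom v ∧ cbar c l a * r v ≤ u := by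
  simp only [Finset.mem_biUnion, Finset.mem_Icc]
  constructor
  · rintro ⟨i, ⟨hi, hij⟩, ha⟩
    exact ⟨mem_pairsFrom_of_mem_Sset ha, (le_iff_of_mem_Sset hr hj hu hi ha).1 hij⟩
  · rintro ⟨ha, hle⟩
    obtain ⟨i, hi, -, hai⟩ := exists_mem_Sset (c := c) (l := l) ha
    exact ⟨i, ⟨hi, (le_iff_of_mem_Sset hr hj hu hi hai).2 hle⟩, hai⟩

theorem mem_biUnion_Sset_iff_lt [DecidableEq (S.E × S.E)] (hr : 0 ≤ r v) (hj : d v c l r j ≤ u)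
    (hu : u < d v c l r (j + 1)) :
    a ∈ (Finset.Icc (j + 1) (cvals v c l).card).biUnion (Sset v c l) ↔
      a ∈ S.pairsFrom v ∧ u < cbar c l a * r v := by
  simp only [Finset.mem_biUnion, Finset.mem_Icc, ← not_le (b := u)]
  constructor
  · rintro ⟨i, ⟨hij, -⟩, ha⟩
    rw [← le_iff_of_mem_Sset hr hj hu (by omega) ha]
    exact ⟨mem_pairsFrom_of_mem_Sset ha, by omega⟩
  · rintro ⟨ha, hlt⟩
    obtain ⟨i, hi, hcard, hai⟩ := exists_mem_Sset (c := c) (l := l) ha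
    rw [← le_iff_of_mem_Sset hr hj hu hi hai] at hlt
    exact ⟨i, ⟨by omega, hcard⟩, hai⟩

theorem limitLaw₁_eq {lam : ℝ} (hr : 0 < r v) (hj : d v c l r j ≤ u)
    (hu : u < d v c l r (j + 1)) :
    limitLaw₁ v c lam l r j u =
      ∑ a ∈ S.pairsFrom v, min (cbar c l a) (u / r v) * (r (S.t a.2) / lam ^ 2) := by
  classical
  rw [← Finset.sum_filter_add_sum_filter_not _ fun a => cbar c l a * r v ≤ u, limitLaw₁,
    Finset.mul_sum]
  congr 1
  · refine Finset.sum_congr ?_ fun a ha => ?_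
    · ext a
      rw [mem_biUnion_Sset_iff hr.le hj hu, Finset.mem_filter]
    · rw [min_eq_left ((le_div_iff₀ hr).2 (Finset.mem_filter.1 ha).2)]
  · refine Finset.sum_congr ?_ fun a ha => ?_
    · ext a
      rw [mem_biUnion_Sset_iff_lt hr.le hj hu, Finset.mem_filter, not_le]
    · rw [min_eq_right ((div_le_iff₀ hr).2 (not_le.1 (Finset.mem_filter.1 ha).2).le)]

end Thresholds

/-! ### The distribution functions and their limits -/

section Laws

variable {hS : S.toDiagram.ProperlyOrdered} {μ : Measure S.X} {lam : ℝ} {r l : Fin m → ℝ}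
  {v : Fin m}

theorem tendsto_returnTime (hP : IsPerronTriple S.M lam r l) (hr_sum : ∑ i, r i = 1)
    (a : S.E × S.E) :
    Tendsto (fun p => (returnTime hS v p a : ℝ) / lam ^ p) atTop
      (𝓝 (cbar (passageCount hS v) l a)) := by
  simp only [returnTime, Nat.cast_sum, Nat.cast_mul, Finset.sum_div, mul_div_assoc]
  exact tendsto_finsetSum _ fun i _ => (tendsto_hgt hP hr_sum i).const_mul _

variable [NeZero m] [IsProbabilityMeasure μ] {p : ℕ} {x : S.X}

theorem entranceLaw_one_eq (h2 : S.H2) (h3 : S.H3) (hμ : MeasurePreserving (vershik hS) μ μ)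
    (hP : IsPerronTriple S.M lam r l) (hr_sum : ∑ i, r i = 1) (hx : term x p = v) {u : ℝ}
    (hu : 0 ≤ u) :
    entranceLaw (vershik hS) μ (cyl x (p + 1)) 1 u =
      ∑ a ∈ S.pairsFrom v, min ((returnTime hS v p a : ℝ) / lam ^ p)
        ((⌊u / r v * lam ^ p⌋₊ : ℝ) / lam ^ p) * (r (S.t a.2) / lam ^ 2) := by
  have hpow := pow_pos hP.eigenvalue_pos p
  have hcyl : μ.real (cyl x (p + 1)) = r v / lam ^ p :=
    hx ▸ measureReal_cyl h2 hμ hP hr_sum x p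
  rw [(isReturnPartition_cylExt hP.pos h2 h3 hx 0).entranceLaw_one hμ (isSweepOut_cyl hP.pos h2 x p)
    (hcyl ▸ div_pos (hP.right_pos v) hpow) hu, hcyl, ← sum_pathsFrom_one]
  refine Finset.sum_congr rfl fun e he => ?_
  rw [measureReal_cylExt h2 hμ hP hr_sum hx he, Nat.cast_min, min_div_div_right hpow.le,
    div_mul_div_comm, ← pow_add, mul_div_assoc, div_div_eq_mul_div, div_mul_eq_mul_div]
  rfl

theorem entranceLaw_eq (h2 : S.H2) (h3 : S.H3) (hμ : MeasurePreserving (vershik hS) μ μ)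
    (hP : IsPerronTriple S.M lam r l) (hr_sum : ∑ i, r i = 1) (hx : term x p = v) {k : ℕ}
    (hk : 2 ≤ k) (u : ℝ)
    [DecidablePred fun e : Fin (k + 1) → S.E =>
      (returnTime hS v p (returnPath hS v k e) : ℝ) / lam ^ p * r v ≤ u] :
    entranceLaw (vershik hS) μ (cyl x (p + 1)) k u =
      ∑ e ∈ S.pathsFrom v k with (returnTime hS v p (returnPath hS v k e) : ℝ) / lam ^ p * r v ≤ u,
        (returnTime hS v p (e 0, e 1) : ℝ) / lam ^ p *
          (r (S.t (e (Fin.last k))) / lam ^ (k + 1)) := by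
  obtain ⟨k, rfl⟩ := Nat.exists_eq_add_of_le' hk
  rw [(isReturnPartition_cylExt hP.pos h2 h3 hx (k + 1)).entranceLaw_add_two hμ
    (isSweepOut_cyl hP.pos h2 x p)
    (Q := fun e => (returnTime hS v p (returnPath hS v (k + 2) e) : ℝ) / lam ^ p * r v ≤ u)]
  · refine Finset.sum_congr rfl fun e he => ?_
    rw [measureReal_cylExt h2 hμ hP hr_sum hx (Finset.mem_filter.1 he).1, div_mul_div_comm,
      ← pow_add, mul_div_assoc]
    rfl
  · intro e _ z hz
    rw [entranceTime_cyl_of_pos hP.pos h2 h3 hx hz.1 (k := k + 2) (by omega), Nat.cast_add,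
      Nat.add_succ_sub_one, add_sub_cancel_left, measureReal_cyl h2 hμ hP hr_sum, hx,
      show (fun a : Fin (k + 2 + 1) => edge z (p + a)) = e from funext hz.2, div_mul_comm]

variable {ι : Type*} {F : Filter ι} {q : ι → ℕ} {j k : ℕ} {K : Set ℝ}

theorem tendstoUniformlyOn_entranceLaw_one [Infinite S.X] (h2 : S.H2) (h3 : S.H3)
    (hμ : MeasurePreserving (vershik hS) μ μ) (hP : IsPerronTriple S.M lam r l)
    (hr_sum : ∑ i, r i = 1) (hq : Tendsto q F atTop) (hx : ∀ i, term x (q i) = v)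
    (hK : ∀ u ∈ K, d v (passageCount hS v) l r j ≤ u ∧ u < d v (passageCount hS v) l r (j + 1)) :
    TendstoUniformlyOn (fun i u => entranceLaw (vershik hS) μ (cyl x (q i + 1)) 1 u)
      (limitLaw₁ v (passageCount hS v) lam l r j) F K := by
  have hnonneg : ∀ u ∈ K, 0 ≤ u := fun u hu => EReal.coe_nonneg.1
    ((d_nonneg (hP.right_pos v).le (fun i => (hP.left_pos i).le) j).trans (hK u hu).1)
  have hpow : Tendsto (fun i => lam ^ q i) F atTop :=
    (tendsto_pow_atTop_atTop_of_one_lt (one_lt_eigenvalue h2 hP)).comp hq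
  have hterm (a : S.E × S.E) : TendstoUniformlyOn
      (fun i u => min ((returnTime hS v (q i) a : ℝ) / lam ^ q i)
        ((⌊u / r v * lam ^ q i⌋₊ : ℝ) / lam ^ q i) * (r (S.t a.2) / lam ^ 2))
      (fun u => min (cbar (passageCount hS v) l a) (u / r v) * (r (S.t a.2) / lam ^ 2)) F K :=
    (uniformContinuous_mul_right' _).comp_tendstoUniformlyOn
      (((tendstoUniformlyOn_min_natFloor ((tendsto_returnTime hP hr_sum a).comp hq) hpow).comp
        (· / r v)).mono fun u hu => div_nonneg (hnonneg u hu) (hP.right_pos v).le)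
  refine ((tendstoUniformlyOn_finsetSum (S.pairsFrom v) fun a _ => hterm a).congr ?_).congr_right ?_
  · exact .of_forall fun i u hu =>
      (entranceLaw_one_eq h2 h3 hμ hP hr_sum (hx i) (hnonneg u hu)).symm
  · exact fun u hu => (limitLaw₁_eq (hP.right_pos v) (hK u hu).1 (hK u hu).2).symm

theorem tendstoUniformlyOn_entranceLaw (h2 : S.H2) (h3 : S.H3)
    (hμ : MeasurePreserving (vershik hS) μ μ) (hP : IsPerronTriple S.M lam r l)
    (hr_sum : ∑ i, r i = 1) (hq : Tendsto q F atTop) (hx : ∀ i, term x (q i) = v) (hk : 2 ≤ k)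
    (hKc : IsClosed K)
    (hK : ∀ u ∈ K, d v (passageCount hS v) l r j ≤ u ∧ u < d v (passageCount hS v) l r (j + 1))
    (hne : ∀ u ∈ K, 1 ≤ j → (u : EReal) ≠ d v (passageCount hS v) l r j) :
    TendstoUniformlyOn (fun i u => entranceLaw (vershik hS) μ (cyl x (q i + 1)) k u)
      (fun _ => limitLaw v (passageCount hS v) (returnPath hS v) lam l r k j) F K := by
  classical
  have hr := (hP.right_pos v).le
  have hlim (a : S.E × S.E) := (tendsto_returnTime (hS := hS) (v := v) hP hr_sum a).comp hq
  have hev : ∀ᶠ i in F, ∀ a ∈ S.pairsFrom v, ∀ u ∈ K,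
      (returnTime hS v (q i) a : ℝ) / lam ^ q i * r v ≤ u ↔
        cbar (passageCount hS v) l a * r v ≤ u :=
    (Finset.eventually_all _).2 fun a ha => eventually_forall_le_iff_le ((hlim a).mul_const (r v))
      hKc fun hmem => cbar_mul_ne hr (hK _ hmem).1 (hK _ hmem).2 (hne _ hmem) ha rfl
  have hsum := tendsto_finsetSum
    {e ∈ S.pathsFrom v k | returnPath hS v k e ∈
      (Finset.Icc 1 j).biUnion (Sset v (passageCount hS v) l)}
    fun e _ => (hlim (e 0, e 1)).mul_const (r (S.t (e (Fin.last k))) / lam ^ (k + 1))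
  refine TendstoUniformlyOn.congr (hsum.tendstoUniformlyOn_const K) ?_
  filter_upwards [hev] with i hi u hu
  refine Eq.trans (Finset.sum_congr (Finset.filter_congr fun e he => ?_) fun _ _ => rfl)
    (entranceLaw_eq h2 h3 hμ hP hr_sum (hx i) hk u).symm
  have hmem := returnPath_mem_pairsFrom (hS := hS) hP.pos h2 h3 (hx i) (by omega) he
  rw [hi _ hmem u hu, mem_biUnion_Sset_iff hr (hK u hu).1 (hK u hu).2, and_iff_right hmem]

end Laws

end StationaryDiagram

theorem theorem2p4 {m : ℕ} [NeZero m] (S : StationaryDiagram m)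
    (hS : S.toDiagram.ProperlyOrdered) (hinf : Infinite S.X)
    (h1 : S.H1) (h2 : S.H2) (h3 : S.H3)
    (lam : ℝ) (r l : Fin m → ℝ)
    (hr : Matrix.mulVec S.M r = lam • r) (hl : Matrix.vecMul l S.M = lam • l)
    (hr_pos : ∀ i, 0 < r i) (hl_pos : ∀ i, 0 < l i)
    (hr_sum : ∑ i, r i = 1) (hlr_sum : ∑ i, l i * r i = 1)
    (μ : MeasureTheory.Measure S.X) [MeasureTheory.IsProbabilityMeasure μ]
    (hμ : MeasureTheory.MeasurePreserving (OrderedBratteliDiagram.vershik hS) μ μ)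
    (x : S.X) (v : Fin m) (ν : ℕ → ℕ) (hν : StrictMono ν)
    (hv : ∀ i, StationaryDiagram.EndsAt x (ν i) v) :
    ∃ (c : S.E → S.E → Fin m → ℕ) (g : ∀ k : ℕ, (Fin (k + 1) → S.E) → S.E × S.E),
      S.IsPassageCount hS v c ∧ S.IsReturnPath hS v g ∧
      ∀ j ≤ (StationaryDiagram.cvals v c l).card,
        -- the first entrance time
        (∀ u : ℝ, StationaryDiagram.d v c l r j ≤ (u : EReal) →
          (u : EReal) < StationaryDiagram.d v c l r (j + 1) →
          Filter.Tendsto (fun i => entranceLaw (OrderedBratteliDiagram.vershik hS) μ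
              (OrderedBratteliDiagram.cyl x (ν i)) 1 u)
            Filter.atTop (nhds (StationaryDiagram.limitLaw₁ v c lam l r j u))) ∧
        (∀ K : Set ℝ, IsClosed K →
          (∀ u ∈ K, StationaryDiagram.d v c l r j < (u : EReal) ∧
            (u : EReal) < StationaryDiagram.d v c l r (j + 1)) →
          TendstoUniformlyOn (fun i u => entranceLaw (OrderedBratteliDiagram.vershik hS) μ
              (OrderedBratteliDiagram.cyl x (ν i)) 1 u)
            (fun u => StationaryDiagram.limitLaw₁ v c lam l r j u) Filter.atTop K) ∧
        -- the later return times
        ∀ k : ℕ, 2 ≤ k →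
          (∀ u : ℝ, StationaryDiagram.d v c l r j ≤ (u : EReal) →
            (u : EReal) < StationaryDiagram.d v c l r (j + 1) →
            (1 ≤ j → (u : EReal) ≠ StationaryDiagram.d v c l r j) →
            Filter.Tendsto (fun i => entranceLaw (OrderedBratteliDiagram.vershik hS) μ
                (OrderedBratteliDiagram.cyl x (ν i)) k u)
              Filter.atTop (nhds (StationaryDiagram.limitLaw v c g lam l r k j))) ∧
          (∀ K : Set ℝ, IsClosed K →
            (∀ u ∈ K, StationaryDiagram.d v c l r j < (u : EReal) ∧
              (u : EReal) < StationaryDiagram.d v c l r (j + 1)) →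
            TendstoUniformlyOn (fun i u => entranceLaw (OrderedBratteliDiagram.vershik hS) μ
                (OrderedBratteliDiagram.cyl x (ν i)) k u)
              (fun _ => StationaryDiagram.limitLaw v c g lam l r k j) Filter.atTop K) := by
  choose p hp hpv using hv
  obtain rfl : ν = fun i => p i + 1 := funext hp
  have hp_tendsto : Filter.Tendsto p Filter.atTop Filter.atTop :=
    StrictMono.tendsto_atTop fun i j hij => Nat.lt_of_succ_lt_succ (hν hij)
  have hP : IsPerronTriple S.M lam r l := ⟨h1, hr, hl, hr_pos, hl_pos, hlr_sum⟩
  refine ⟨StationaryDiagram.passageCount hS v, StationaryDiagram.returnPath hS v,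
    StationaryDiagram.isPassageCount_passageCount h1 h2 h3 v,
    StationaryDiagram.isReturnPath_returnPath h1 h2 h3 v, fun j _ => ?_⟩
  have hfirst {K : Set ℝ} := StationaryDiagram.tendstoUniformlyOn_entranceLaw_one
    (K := K) (j := j) h2 h3 hμ hP hr_sum hp_tendsto hpv
  have hlater {K : Set ℝ} {k : ℕ} := StationaryDiagram.tendstoUniformlyOn_entranceLaw
    (K := K) (j := j) (k := k) h2 h3 hμ hP hr_sum hp_tendsto hpv
  refine ⟨fun u hu hu_lt => ?_, fun K _ hK => ?_, fun k hk =>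
    ⟨fun u hu hu_lt hu_ne => ?_, fun K hKc hK => ?_⟩⟩
  · exact (hfirst (K := {u}) (by rintro _ rfl; exact ⟨hu, hu_lt⟩)).tendsto_at rfl
  · exact hfirst fun u hu => ⟨(hK u hu).1.le, (hK u hu).2⟩
  · exact (hlater (K := {u}) hk isClosed_singleton (by rintro _ rfl; exact ⟨hu, hu_lt⟩)
      (by rintro _ rfl; exact hu_ne)).tendsto_at rfl
  · exact hlater hk hKc (fun u hu => ⟨(hK u hu).1.le, (hK u hu).2⟩)
      fun u hu _ => (hK u hu).1.ne'
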